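/- Let $n\ge 2$, let $\overline{\mathbb R}^n=\mathbb R^n\cup\{\infty\}$ be the one-point compactification of $\mathbb R^n$, and let $G\subset\overline{\mathbb R}^n$ be a domain (a non-empty connected open set) whose boundary $\partial G$ in $\overline{\mathbb R}^n$ has at least two points. Then $\partial G$ is uniformly perfect if and only if there exists a constant $b>0$ such that $$\mu_G(x,y)\ \ge\ b\,\delta_G(x,y)\qquad\text{for all }x,y\in G .$$ Here the notions are as follows. (a) A compact set $E\subset\overline{\mathbb R}^n$ with at least two points is *uniformly perfect* if there is a constant $c\in(0,1)$ such that $E$ meets the closed annulus $\{x\in\mathbb R^n: cr\le|x-a|\le r\}$ whenever $a\in E\setminus\{\infty\}$ and $0<r<\operatorname{diam}(E)$, where $\operatorname{diam}(E)$ is the Euclidean diameter of $E$, and $\operatorname{diam}(E)=+\infty$ if $\infty\in E$. (b) *Seittenranta's Möbius metric* is $\delta_G(x,y)=\log\bigl(1+\sup_{a,b\in\partial G}|a,x,b,y|\bigr)$, where $|a,b,c,d|=\dfrac{|a-c|\,|b-d|}{|a-b|\,|c-d|}$ is the absolute (cross) ratio, understood as the corresponding limit if one of the points is $\infty$ (and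 as $0$ if $a=c$ or $b=d$). (c) The *modulus metric* is $\mu_G(x,y)=\inf_{C}\mathsf M(\Delta(C,\partial G;G))$, where the infimum runs over all curves $C$ in $G$ joining $x$ and $y$. Here $\Delta(E,F;G)$ is the family of all curves $\gamma:[\alpha,\beta]\to\overline{\mathbb R}^n$ with $\gamma(\alpha)\in E$, $\gamma(\beta)\in F$ and $\gamma((\alpha,\beta))\subset G$, and the conformal modulus of a curve family $\Gamma$ is $\mathsf M(\Gamma)=\inf_\rho\int_{\mathbb R^n}\rho^n\,dm$, with $m$ the $n$-dimensional Lebesgue measure, the infimum being over all Borel functions $\rho:\mathbb R^n\to[0,+\infty]$ such that $\int_\gamma\rho\,ds\ge1$ for every (locally) rectifiable curve $\gamma\in\Gamma$ ($\mathsf M(\Gamma)=+\infty$ if there is none); curves through $\infty$ have infinite length and impose no condition. -/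

import Mathlib

open Set MeasureTheory
open scoped ENNReal unitInterval

noncomputable section

/-- Euclidean `n`-space. -/
abbrev Rn (n : ℕ) : Type := EuclideanSpace ℝ (Fin n)

/-- The Möbius space: the one-point compactification of Euclidean `n`-space. -/
abbrev MobiusSpace (n : ℕ) : Type := OnePoint (Rn n)

/-- A domain: a non-empty connected open subset of the Möbius space. -/
def IsMobiusDomain {n : ℕ} (G : Set (MobiusSpace n)) : Prop :=
  IsOpen G ∧ IsConnected G

/-! ### Uniformly perfect sets -/

open Classical in
/-- The Euclidean diameter of a subset of the Möbius space, `∞` if the set contains the point at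
infinity. -/
def euclideanDiam {n : ℕ} (E : Set (MobiusSpace n)) : ℝ≥0∞ :=
  if OnePoint.infty ∈ E then ⊤ else Metric.ediam {x : Rn n | (x : MobiusSpace n) ∈ E}

/-- A compact set `E` with at least two points is uniformly perfect if for some `c ∈ (0, 1)` it
meets each closed annulus `c r ≤ |x - a| ≤ r` with `a ∈ E` finite and `0 < r < diam E`. -/
def IsUniformlyPerfect {n : ℕ} (E : Set (MobiusSpace n)) : Prop :=
  IsCompact E ∧ E.Nontrivial ∧
    ∃ c : ℝ, 0 < c ∧ c < 1 ∧
      ∀ a : Rn n, (a : MobiusSpace n) ∈ E →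
        ∀ r : ℝ, 0 < r → ENNReal.ofReal r < euclideanDiam E →
          ∃ x : Rn n, (x : MobiusSpace n) ∈ E ∧ c * r ≤ dist x a ∧ dist x a ≤ r

/-! ### The Möbius metric -/

/-- The factor `|x - y|` of an absolute ratio. A factor in which exactly one point is infinite
counts as `1`: in an absolute ratio each point occurs in one factor of the numerator and in one
factor of the denominator, and the quotient of these two tends to `1` as the point tends to
infinity. -/
def ratioFactor {n : ℕ} : MobiusSpace n → MobiusSpace n → ℝ
  | some x, some y => dist x y
  | some _, none => 1
  | none, some _ => 1
  | none, none => 0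

/-- The absolute (cross) ratio `|a, b, c, d| = |a - c| |b - d| / (|a - b| |c - d|)`, with its
limit values if one of the points is infinite. -/
def absoluteRatio {n : ℕ} (a b c d : MobiusSpace n) : ℝ :=
  (ratioFactor a c * ratioFactor b d) / (ratioFactor a b * ratioFactor c d)

/-- `m_G(x, y)`, the supremum of `|a, x, b, y|` over all boundary points `a`, `b` of `G`. -/
def supAbsoluteRatio {n : ℕ} (G : Set (MobiusSpace n)) (x y : MobiusSpace n) : ℝ :=
  sSup {t : ℝ | ∃ a ∈ frontier G, ∃ b ∈ frontier G, t = absoluteRatio a x b y}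

/-- Seittenranta's Möbius metric `δ_G(x, y) = log (1 + m_G(x, y))`. -/
def mobiusMetric {n : ℕ} (G : Set (MobiusSpace n)) (x y : MobiusSpace n) : ℝ :=
  Real.log (1 + supAbsoluteRatio G x y)

/-! ### The conformal modulus of a curve family -/

/-- A (closed) curve in the Möbius space, parametrized by the unit interval. -/
abbrev Curve (n : ℕ) : Type := C(I, MobiusSpace n)

/-- A curve in Euclidean space, seen as a curve in the Möbius space. -/
def finiteCurve {n : ℕ} (γ : C(I, Rn n)) : Curve n :=
  ⟨fun t => (γ t : MobiusSpace n), OnePoint.continuous_coe.comp γ.continuous⟩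

/-- The Euclidean length of a curve. -/
def curveLength {n : ℕ} (γ : C(I, Rn n)) : ℝ≥0∞ := eVariationOn γ univ

/-- The line integral `∫_γ ρ ds` over a rectifiable curve: the integral of `ρ` along the
parametrization of `γ` by arc length. -/
def lineIntegral {n : ℕ} (ρ : Rn n → ℝ≥0∞) (γ : C(I, Rn n)) : ℝ≥0∞ :=
  ∫⁻ s in Icc (0 : ℝ) (curveLength γ).toReal, ρ (naturalParameterization γ univ 0 s)

/-- Admissible functions for a family `Γ` of curves. A curve with a compact parameter interval is
locally rectifiable iff it has finite Euclidean length; such a curve does not pass through the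
point at infinity. -/
def IsAdmissible {n : ℕ} (Γ : Set (Curve n)) (ρ : Rn n → ℝ≥0∞) : Prop :=
  Measurable ρ ∧
    ∀ γ : C(I, Rn n), finiteCurve γ ∈ Γ → curveLength γ ≠ ⊤ → 1 ≤ lineIntegral ρ γ

/-- The conformal modulus of a curve family, `∞` if there is no admissible function. -/
def conformalModulus {n : ℕ} (Γ : Set (Curve n)) : ℝ≥0∞ :=
  ⨅ (ρ : Rn n → ℝ≥0∞) (_ : IsAdmissible Γ ρ), ∫⁻ x, ρ x ^ n

/-- `Δ(E, F; G)`: the family of all curves joining `E` and `F` in `G`. -/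
def joiningCurves {n : ℕ} (E F G : Set (MobiusSpace n)) : Set (Curve n) :=
  {γ | γ 0 ∈ E ∧ γ 1 ∈ F ∧ ∀ t : I, 0 < t → t < 1 → γ t ∈ G}

/-- The modulus metric `μ_G(x, y)`: the infimum of the moduli of `Δ(C, ∂G; G)` over all curves
`C` in `G` joining `x` and `y`. -/
def modulusMetric {n : ℕ} (G : Set (MobiusSpace n)) (x y : MobiusSpace n) : ℝ≥0∞ :=
  ⨅ (γ : Path x y) (_ : range γ ⊆ G), conformalModulus (joiningCurves (range γ) (frontier G) G)

end

noncomputable section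

/-! ### Arc length parametrization -/

section ArcLength

variable {n : ℕ}

/-! Necessity. If uniform perfectness fails badly, some ring `s ≤ |z - a| ≤ 4 ^ N s` centred at a
boundary point `a` misses `∂G` although `∂G` has points beyond it. As `G` is connected, the ring
lies in `G` (`annulus_subset_of_separates`). Antipodal points of the middle sphere have Möbius
distance at least `log 2` (`log_two_le_mobiusMetric`). They are joined by a path on that sphere, and
a curve from there to `∂G` must cross half of the ring. The density `2 / (N |z - a|)` on the ring
then bounds the modulus by a constant over `N` (`conformalModulus_le_of_ring`), which contradicts `μ
≥ b δ` for large `N`.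

Sufficiency. Let `C` join `x` and `y` in `G`, let `d` be the distance to the finite part of `∂G`,
and for finite `x`, `y` let `R = min(|x - y|, diam ∂G)`. The triangle inequality gives `1 + |a, x,
b, y| ≤ (1 + R / d(x)) (1 + R / d(y))`, so it is enough to bound `∫ ρ ^ n` below by a multiple of
`log (1 + R / d(u))` for `u = x` and `u = y`, for every admissible `ρ` (`exists_log_lower_bound`).
Let `a` be a boundary point nearest to `u`. Between the scales `d(u)` and `R` there are about `log
(R / d(u))` disjoint rings around `a`. In each of them both `C`, being connected, and `∂G`, being
uniformly perfect, are thick, and each ring contributes a fixed amount; if `R / d(u)` is bounded,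
one estimate linear in `R / (d(u) + R)` is enough.

The estimate for two thick sets (`exists_lower_bound_of_thick`) is probabilistic. A thick set
carries a Frostman measure, built on a binary Cantor tree, whose potentials with kernel `|z - p| ^
(-β)` are bounded for some `β > 0`. Choose `p` in one set and `q` in the other by these measures and
`w` uniformly in a ball. The broken line from `p` over `w` to `q` contains a curve of the family, so
the integrals of `ρ` over its two segments add up to at least `1`. Averaging, a weighted Hölder
inequality and the substitution `z = p + t (w - p)` bound the mean of these integrals by the `L ^ n`
norm of `ρ` and the potential. -/

lemma continuous_variationOnFromTo {γ : C(I, Rn n)} (hγ : curveLength γ ≠ ⊤) :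
    Continuous (variationOnFromTo γ univ 0) := by
  have hb : BoundedVariationOn γ univ := hγ
  have hl := hb.locallyBoundedVariationOn
  rw [continuous_iff_continuousAt]
  intro t
  rw [continuousAt_iff_continuous_left'_right']
  constructor
  · have h := variationOnFromTo.tendsto_left (f := γ) (s := univ) (l := γ t) (mem_univ 0)
      (mem_univ t) hl (by simpa using γ.continuous.continuousWithinAt.tendsto)
    simpa [ContinuousWithinAt] using h
  · have h := variationOnFromTo.tendsto_right (f := γ) (s := univ) (l := γ t) (mem_univ 0)
      (mem_univ t) hl (by simpa using γ.continuous.continuousWithinAt.tendsto)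
    simpa [ContinuousWithinAt] using h

lemma image_variationOnFromTo {γ : C(I, Rn n)} (hγ : curveLength γ ≠ ⊤) :
    variationOnFromTo γ univ 0 '' univ = Icc 0 (curveLength γ).toReal := by
  have hb : BoundedVariationOn γ univ := hγ
  have hl := hb.locallyBoundedVariationOn
  have h0 : variationOnFromTo γ univ 0 0 = 0 := variationOnFromTo.self _ _ _
  have h1 : variationOnFromTo γ univ 0 1 = (curveLength γ).toReal := by
    rw [variationOnFromTo.eq_of_le _ _ zero_le_one]
    congr 2
    ext x
    simpa using unitInterval.le_one'
  have hm := variationOnFromTo.monotoneOn hl (mem_univ (0 : I))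
  apply Subset.antisymm
  · rintro _ ⟨t, -, rfl⟩
    rw [mem_Icc, ← h0, ← h1]
    exact ⟨hm (mem_univ _) (mem_univ _) t.2.1, hm (mem_univ _) (mem_univ _) t.2.2⟩
  · rw [← h0, ← h1, image_univ]
    intro s hs
    exact mem_range_of_exists_le_of_exists_ge (continuous_variationOnFromTo hγ) ⟨0, hs.1⟩ ⟨1, hs.2⟩

lemma lipschitzOnWith_naturalParameterization {γ : C(I, Rn n)} (hγ : curveLength γ ≠ ⊤) :
    LipschitzOnWith 1 (naturalParameterization γ univ 0) (Icc 0 (curveLength γ).toReal) := by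
  have hb : BoundedVariationOn γ univ := hγ
  have h := has_unit_speed_naturalParameterization γ hb.locallyBoundedVariationOn (mem_univ 0)
  rw [image_variationOnFromTo hγ] at h
  have key : ∀ x ∈ Icc 0 (curveLength γ).toReal, ∀ y ∈ Icc 0 (curveLength γ).toReal, x ≤ y →
      edist (naturalParameterization γ univ 0 x) (naturalParameterization γ univ 0 y) ≤
        edist x y := by
    intro x hx y hy hxy
    refine (eVariationOn.edist_le _ (s := Icc 0 (curveLength γ).toReal ∩ Icc x y)
      ⟨hx, le_rfl, hxy⟩ ⟨hy, hxy, le_rfl⟩).trans ?_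
    rw [h hx hy, edist_comm, edist_dist, Real.dist_eq, abs_of_nonneg (sub_nonneg.2 hxy)]
    simp
  intro x hx y hy
  rw [ENNReal.coe_one, one_mul]
  rcases le_total x y with hxy | hxy
  · exact key x hx y hy hxy
  · rw [edist_comm, edist_comm x]
    exact key y hy x hx hxy

lemma exists_naturalParameterization_eq {γ : C(I, Rn n)} (hγ : curveLength γ ≠ ⊤) (t : I) :
    ∃ s ∈ Icc 0 (curveLength γ).toReal, naturalParameterization γ univ 0 s = γ t := by
  have hb : BoundedVariationOn γ univ := hγ
  refine ⟨variationOnFromTo γ univ 0 t, ?_, ?_⟩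
  · rw [← image_variationOnFromTo hγ]
    exact mem_image_of_mem _ (mem_univ t)
  · exact edist_eq_zero.1
      (edist_naturalParameterization_eq_zero hb.locallyBoundedVariationOn (mem_univ _) (mem_univ _))

/-- A curve of finite length has a `1`-Lipschitz parametrization by arc length. -/
lemma exists_lipschitz_parametrization {γ : C(I, Rn n)} (hγ : curveLength γ ≠ ⊤) :
    ∃ f : ℝ → Rn n, LipschitzWith 1 f ∧
      (∀ ρ, lineIntegral ρ γ = ∫⁻ s in Icc (0 : ℝ) (curveLength γ).toReal, ρ (f s)) ∧
      ∀ t, ∃ s ∈ Icc 0 (curveLength γ).toReal, f s = γ t := by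
  have h0 : (0 : ℝ) ≤ (curveLength γ).toReal := ENNReal.toReal_nonneg
  have hL := lipschitzOnWith_naturalParameterization hγ
  have heq : ∀ s ∈ Icc 0 (curveLength γ).toReal,
      IccExtend h0 ((Icc 0 (curveLength γ).toReal).domRestrict (naturalParameterization γ univ 0)) s =
        naturalParameterization γ univ 0 s := fun s hs => by
    rw [IccExtend_of_mem _ _ hs]; rfl
  -- Extending by constants beyond the two ends gives a map that is Lipschitz on all of `ℝ`, so
  -- measurability on the line comes for free.
  refine ⟨IccExtend h0
    ((Icc 0 (curveLength γ).toReal).domRestrict (naturalParameterization γ univ 0)), ?_, ?_, ?_⟩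
  · have := hL.to_restrict.comp (LipschitzWith.projIcc h0)
    rwa [one_mul] at this
  · intro ρ
    unfold lineIntegral
    refine setLIntegral_congr_fun measurableSet_Icc fun s hs => ?_
    simp only [heq s hs]
  · intro t
    obtain ⟨s, hs, h⟩ := exists_naturalParameterization_eq hγ t
    exact ⟨s, hs, (heq s hs).trans h⟩

lemma isPreconnected_image_dist_curve (γ : C(I, Rn n)) (a : Rn n) :
    IsPreconnected (range fun t => dist (γ t) a) :=
  isPreconnected_range (γ.continuous.dist continuous_const)

/-- A curve crossing a spherical shell has length at least the width of the shell inside it. -/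
lemma le_volume_shell {f : ℝ → Rn n} (hf : LipschitzWith 1 f) {γ : C(I, Rn n)} {S : Set ℝ}
    (hS : ∀ t, ∃ s ∈ S, f s = γ t) (a : Rn n) {α β : ℝ} {t₁ t₂ : I}
    (h₁ : dist (γ t₁) a ≤ α) (h₂ : β ≤ dist (γ t₂) a) :
    ENNReal.ofReal (β - α) ≤ volume (S ∩ {s | dist (f s) a ∈ Ico α β}) := by
  have hlip : LipschitzWith 1 fun s => dist (f s) a := by
    have := (LipschitzWith.dist_left a).comp hf
    rwa [one_mul] at this
  -- By connectedness the distance to `a` takes every value in `[α, β)`. It is `1`-Lipschitz in the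
  -- arc length, so it does not increase one-dimensional Hausdorff measure.
  have hsub : Ico α β ⊆ (fun s => dist (f s) a) '' (S ∩ {s | dist (f s) a ∈ Ico α β}) := by
    intro u hu
    have : u ∈ range fun t => dist (γ t) a :=
      (isPreconnected_image_dist_curve γ a).ordConnected.out ⟨t₁, rfl⟩ ⟨t₂, rfl⟩
        ⟨h₁.trans hu.1, hu.2.le.trans h₂⟩
    obtain ⟨t, rfl⟩ := this
    obtain ⟨s, hs, h⟩ := hS t
    refine ⟨s, ⟨hs, ?_⟩, ?_⟩
    · simpa [h] using hu
    · simp [h]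
  calc ENNReal.ofReal (β - α) = volume (Ico α β) := by simp
    _ ≤ _ := measure_mono hsub
    _ ≤ _ := by
      have := (hlip.lipschitzOnWith (s := (S ∩ {s | dist (f s) a ∈ Ico α β}))).hausdorffMeasure_image_le
        (d := 1) zero_le_one
      simpa [hausdorffMeasure_real] using this

end ArcLength

/-! ### Modulus of curves crossing a ring -/

section Ring

variable {n : ℕ}

lemma exists_mem_Ico_two_pow {s u : ℝ} (M : ℕ) (h₁ : s ≤ u) (h₂ : u < 2 ^ M * s) :
    ∃ k < M, u ∈ Ico (2 ^ k * s) (2 ^ (k + 1) * s) := by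
  induction M with
  | zero => simp only [pow_zero, one_mul] at h₂; exact absurd h₂ h₁.not_gt
  | succ M ih =>
    by_cases h : u < 2 ^ M * s
    · obtain ⟨k, hk, hu⟩ := ih h
      exact ⟨k, hk.trans (Nat.lt_succ_self M), hu⟩
    · exact ⟨M, Nat.lt_succ_self M, not_lt.1 h, h₂⟩

/-- The density `2 / (N |z - a|)` on the ring `s ≤ |z - a| < 4 ^ N s`. -/
def ringDensity (N : ℕ) (a : Rn n) (s : ℝ) : Rn n → ℝ≥0∞ :=
  indicator {z | dist z a ∈ Ico s (2 ^ (2 * N) * s)} fun z => ENNReal.ofReal (2 / (N * dist z a))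

lemma measurableSet_shell (a : Rn n) (α β : ℝ) : MeasurableSet {z : Rn n | dist z a ∈ Ico α β} :=
  (measurable_id.dist measurable_const) measurableSet_Ico

lemma measurable_ringDensity (N : ℕ) (a : Rn n) (s : ℝ) : Measurable (ringDensity N a s) := by
  refine Measurable.indicator ?_ (measurableSet_shell a _ _)
  fun_prop

lemma ringDensity_le {N : ℕ} (hN : 0 < N) {a : Rn n} {s : ℝ} (hs : 0 < s) {k : ℕ} {z : Rn n}
    (hz : dist z a ∈ Ico (2 ^ k * s) (2 ^ (k + 1) * s)) :
    ringDensity N a s z ≤ ENNReal.ofReal (2 / (N * (2 ^ k * s))) := by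
  have hN' : (0 : ℝ) < N := by exact_mod_cast hN
  refine (indicator_le_self _ _ _).trans (ENNReal.ofReal_le_ofReal ?_)
  have := hz.1
  gcongr

lemma le_ringDensity {N : ℕ} (hN : 0 < N) {a : Rn n} {s : ℝ} (hs : 0 < s) {k : ℕ}
    (hk : k < 2 * N) {z : Rn n} (hz : dist z a ∈ Ico (2 ^ k * s) (2 ^ (k + 1) * s)) :
    ENNReal.ofReal (1 / (N * (2 ^ k * s))) ≤ ringDensity N a s z := by
  have hN' : (0 : ℝ) < N := by exact_mod_cast hN
  have h1 : (1 : ℝ) ≤ 2 ^ k := one_le_pow₀ (by norm_num)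
  have h2 : (2 : ℝ) ^ (k + 1) ≤ 2 ^ (2 * N) := pow_le_pow_right₀ (by norm_num) (by omega)
  have hpos : 0 < dist z a := lt_of_lt_of_le (by positivity) hz.1
  rw [ringDensity, indicator_of_mem]
  · apply ENNReal.ofReal_le_ofReal
    rw [div_le_div_iff₀ (by positivity) (by positivity)]
    have := hz.2
    rw [pow_succ] at this
    nlinarith
  · exact ⟨le_trans (by nlinarith) hz.1, hz.2.trans_le (by nlinarith)⟩

/-- On a dyadic shell the density is comparable to `1 / (N · radius)` and the volume to `radius ^
n`, so each of the `2 N` shells costs at most `(4 / N) ^ n` times the volume of the unit ball. Since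
`n ≥ 2`, the sum still decays like `1 / N`. -/
lemma lintegral_ringDensity_pow_le (hn : 2 ≤ n) {N : ℕ} (hN : 0 < N) (a : Rn n) {s : ℝ}
    (hs : 0 < s) :
    ∫⁻ z, ringDensity N a s z ^ n ≤
      ENNReal.ofReal (2 * 4 ^ n / N) * volume (Metric.ball (0 : Rn n) 1) := by
  have hN' : (0 : ℝ) < N := by exact_mod_cast hN
  have hN1 : (1 : ℝ) ≤ N := by exact_mod_cast hN
  let sh : ℕ → Set (Rn n) := fun k => {z | dist z a ∈ Ico (2 ^ k * s) (2 ^ (k + 1) * s)}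
  have hpt : ∀ z, ringDensity N a s z ^ n ≤ ∑ k ∈ Finset.range (2 * N),
      (sh k).indicator (fun _ => ENNReal.ofReal ((2 / (N * (2 ^ k * s))) ^ n)) z := by
    intro z
    by_cases hz : dist z a ∈ Ico s (2 ^ (2 * N) * s)
    · obtain ⟨k, hk, hzk⟩ := exists_mem_Ico_two_pow _ hz.1 hz.2
      refine le_trans ?_ (Finset.single_le_sum (fun _ _ => zero_le) (Finset.mem_range.2 hk))
      rw [indicator_of_mem (show z ∈ sh k from hzk), ENNReal.ofReal_pow (by positivity)]
      gcongr
      exact ringDensity_le hN hs hzk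
    · rw [ringDensity, indicator_of_notMem (by exact hz), zero_pow (by omega)]
      exact zero_le
  refine (lintegral_mono hpt).trans ?_
  rw [lintegral_finsetSum _ fun k _ => measurable_const.indicator (measurableSet_shell a _ _)]
  have hterm : ∀ k ∈ Finset.range (2 * N),
      ∫⁻ z, (sh k).indicator (fun _ => ENNReal.ofReal ((2 / (N * (2 ^ k * s))) ^ n)) z ≤
        ENNReal.ofReal ((4 / N) ^ n) * volume (Metric.ball (0 : Rn n) 1) := by
    intro k _
    rw [lintegral_indicator (measurableSet_shell a _ _), setLIntegral_const]
    have hv : volume (sh k) ≤ ENNReal.ofReal ((2 ^ (k + 1) * s) ^ n) *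
        volume (Metric.ball (0 : Rn n) 1) := by
      have := Measure.addHaar_ball_of_pos (volume : Measure (Rn n)) a
        (show (0 : ℝ) < 2 ^ (k + 1) * s by positivity)
      rw [finrank_euclideanSpace_fin] at this
      rw [← this]
      exact measure_mono fun z hz => hz.2
    calc _ ≤ ENNReal.ofReal ((2 / (N * (2 ^ k * s))) ^ n) * (ENNReal.ofReal ((2 ^ (k + 1) * s) ^ n) *
        volume (Metric.ball (0 : Rn n) 1)) := by gcongr
      _ = _ := by
        rw [← mul_assoc, ← ENNReal.ofReal_mul (by positivity), ← mul_pow]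
        congr 3
        field_simp
        ring
  refine (Finset.sum_le_sum hterm).trans ?_
  rw [Finset.sum_const, Finset.card_range, nsmul_eq_mul, ← mul_assoc]
  gcongr
  rw [← ENNReal.ofReal_natCast, ← ENNReal.ofReal_mul (by positivity)]
  apply ENNReal.ofReal_le_ofReal
  push_cast
  rw [div_pow, ← mul_div_assoc, div_le_div_iff₀ (by positivity) hN']
  have : (N : ℝ) ^ 2 ≤ N ^ n := pow_le_pow_right₀ hN1 hn
  have h4 : (0 : ℝ) < 4 ^ n := by positivity
  nlinarith

/-- Starting on the middle sphere, the curve crosses `N` dyadic shells whichever way it leaves the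
ring. In each one, width times minimal density is `1 / N`. -/
lemma one_le_lineIntegral_ringDensity {N : ℕ} (hN : 0 < N) {a : Rn n} {s : ℝ}
    (hs : 0 < s) {γ : C(I, Rn n)} (hγ : curveLength γ ≠ ⊤) (h0 : dist (γ 0) a = 2 ^ N * s)
    (h1 : dist (γ 1) a ≤ s ∨ 2 ^ (2 * N) * s ≤ dist (γ 1) a) :
    1 ≤ lineIntegral (ringDensity N a s) γ := by
  have hN' : (0 : ℝ) < N := by exact_mod_cast hN
  obtain ⟨f, hf, hint, hsurj⟩ := exists_lipschitz_parametrization hγ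
  rw [hint]
  set S := Icc (0 : ℝ) (curveLength γ).toReal
  let sh : ℕ → Set ℝ := fun k => {u | dist (f u) a ∈ Ico (2 ^ k * s) (2 ^ (k + 1) * s)}
  have hshm : ∀ k, MeasurableSet (sh k) := fun k =>
    (hf.continuous.dist continuous_const).measurable measurableSet_Ico
  have hmono : Monotone fun k : ℕ => (2 : ℝ) ^ k * s := fun i j hij => by
    have : (2 : ℝ) ^ i ≤ 2 ^ j := pow_le_pow_right₀ (by norm_num) hij
    dsimp only
    gcongr
  have hdisj : Pairwise (Function.onFun Disjoint sh) := fun i j hij =>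
    (hmono.pairwise_disjoint_on_Ico_succ hij).preimage _
  have key : ∀ T : Finset ℕ, T.card = N → (∀ k ∈ T, k < 2 * N ∧
      ENNReal.ofReal (2 ^ (k + 1) * s - 2 ^ k * s) ≤ volume (S ∩ sh k)) →
      1 ≤ ∫⁻ u in S, ringDensity N a s (f u) := by
    intro T hT h
    calc (1 : ℝ≥0∞) = ∑ k ∈ T, ENNReal.ofReal (1 / N) := by
          rw [Finset.sum_const, hT, nsmul_eq_mul, ← ENNReal.ofReal_natCast,
            ← ENNReal.ofReal_mul (by positivity), mul_one_div_cancel hN'.ne', ENNReal.ofReal_one]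
      _ ≤ ∑ k ∈ T, ∫⁻ u in S ∩ sh k, ringDensity N a s (f u) := by
          refine Finset.sum_le_sum fun k hk => ?_
          calc ENNReal.ofReal (1 / N) = ENNReal.ofReal (1 / (N * (2 ^ k * s))) *
                ENNReal.ofReal (2 ^ (k + 1) * s - 2 ^ k * s) := by
                rw [← ENNReal.ofReal_mul (by positivity)]
                congr 1
                field_simp
                ring
            _ ≤ ENNReal.ofReal (1 / (N * (2 ^ k * s))) * volume (S ∩ sh k) := by
                gcongr
                exact (h k hk).2
            _ = ∫⁻ u in S ∩ sh k, ENNReal.ofReal (1 / (N * (2 ^ k * s))) := by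
                rw [setLIntegral_const]
            _ ≤ _ := setLIntegral_mono' (measurableSet_Icc.inter (hshm k)) fun u hu =>
                le_ringDensity hN hs (h k hk).1 hu.2
      _ = ∫⁻ u in ⋃ k ∈ T, S ∩ sh k, ringDensity N a s (f u) := by
          rw [lintegral_biUnion_finset _ fun k _ => measurableSet_Icc.inter (hshm k)]
          exact fun i _ j _ hij => (hdisj hij).mono inter_subset_right inter_subset_right
      _ ≤ _ := lintegral_mono_set (iUnion₂_subset fun _ _ => inter_subset_left)
  rcases h1 with h1 | h1
  · refine key (Finset.range N) (by simp) fun k hk => ?_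
    rw [Finset.mem_range] at hk
    refine ⟨by omega, le_volume_shell hf hsurj a (t₁ := 1) (t₂ := 0) (h1.trans ?_) ?_⟩
    · simpa using hmono (Nat.zero_le k)
    · rw [h0]
      exact hmono (show k + 1 ≤ N by omega)
  · refine key (Finset.Ico N (2 * N)) (by simp; omega) fun k hk => ?_
    rw [Finset.mem_Ico] at hk
    refine ⟨by omega, le_volume_shell hf hsurj a (t₁ := 0) (t₂ := 1) ?_ (le_trans ?_ h1)⟩
    · rw [h0]
      exact hmono hk.1
    · exact hmono (show k + 1 ≤ 2 * N by omega)

lemma conformalModulus_le_of_ring (hn : 2 ≤ n) {N : ℕ} (hN : 0 < N) {a : Rn n} {s : ℝ}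
    (hs : 0 < s) {Γ : Set (Curve n)}
    (hΓ : ∀ γ : C(I, Rn n), finiteCurve γ ∈ Γ → dist (γ 0) a = 2 ^ N * s ∧
      (dist (γ 1) a ≤ s ∨ 2 ^ (2 * N) * s ≤ dist (γ 1) a)) :
    conformalModulus Γ ≤
      ENNReal.ofReal (2 * 4 ^ n / N) * volume (Metric.ball (0 : Rn n) 1) :=
  (iInf₂_le (ringDensity N a s) ⟨measurable_ringDensity N a s, fun γ hγ hlen =>
    one_le_lineIntegral_ringDensity hN hs hlen (hΓ γ hγ).1 (hΓ γ hγ).2⟩).trans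
    (lintegral_ringDensity_pow_le hn hN a hs)

end Ring

/-! ### Topology of the Möbius space -/

section Topology

variable {n : ℕ}

lemma isOpen_coe_ball (a : Rn n) (r : ℝ) :
    IsOpen ((↑) '' Metric.ball a r : Set (MobiusSpace n)) :=
  OnePoint.isOpen_image_coe.2 Metric.isOpen_ball

lemma isOpen_compl_coe_closedBall (a : Rn n) (r : ℝ) :
    IsOpen ((↑) '' Metric.closedBall a r : Set (MobiusSpace n))ᶜ :=
  OnePoint.isOpen_compl_image_coe.2 ⟨Metric.isClosed_closedBall, isCompact_closedBall a r⟩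

/-- A connected set with points on both sides of a sphere meets the sphere. -/
lemma IsPreconnected.exists_dist_eq {K : Set (MobiusSpace n)} (hK : IsPreconnected K) {a : Rn n}
    {r : ℝ} {p : Rn n} (hp : (p : MobiusSpace n) ∈ K) (hpr : dist p a ≤ r)
    {q : MobiusSpace n} (hq : q ∈ K) (hqr : ∀ z : Rn n, q = z → r ≤ dist z a) :
    ∃ z : Rn n, (z : MobiusSpace n) ∈ K ∧ dist z a = r := by
  by_contra! h
  have hsub : K ⊆ (↑) '' Metric.ball a r ∪ ((↑) '' Metric.closedBall a r)ᶜ := by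
    intro w hw
    induction w using OnePoint.rec with
    | infty => right; simp
    | coe z =>
      rcases lt_trichotomy (dist z a) r with hz | hz | hz
      · exact Or.inl ⟨z, hz, rfl⟩
      · exact absurd hz (h z hw)
      · right
        rintro ⟨z', hz', he⟩
        rw [OnePoint.coe_eq_coe] at he
        subst he
        exact absurd hz (not_lt.2 hz')
  obtain ⟨w, -, ⟨z, hz, rfl⟩, hz'⟩ := hK _ _ (isOpen_coe_ball a r)
    (isOpen_compl_coe_closedBall a r) hsub
    ⟨p, hp, p, lt_of_le_of_ne hpr (h p hp), rfl⟩
    ⟨q, hq, by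
      rintro ⟨z, hz, rfl⟩
      exact h z hq (le_antisymm hz (hqr z rfl))⟩
  exact hz' ⟨z, Metric.ball_subset_closedBall hz, rfl⟩

lemma IsPreconnected.subset_of_disjoint_frontier {X : Type*} [TopologicalSpace X] {K G : Set X}
    (hK : IsPreconnected K) (hG : IsOpen G) (h : ∀ x ∈ K, x ∉ frontier G)
    (hne : (K ∩ G).Nonempty) : K ⊆ G := by
  refine hK.subset_left_of_subset_union hG isClosed_closure.isOpen_compl
    (disjoint_compl_right.mono_left subset_closure) (fun x hxK => ?_) hne
  by_cases hx : x ∈ closure G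
  · left
    by_contra hxG
    refine h x hxK ?_
    rw [frontier, hG.interior_eq]
    exact ⟨hx, hxG⟩
  · exact Or.inr hx

lemma one_lt_rank_Rn (hn : 2 ≤ n) : 1 < Module.rank ℝ (Rn n) := by
  rw [← Module.finrank_eq_rank, finrank_euclideanSpace_fin]
  exact_mod_cast hn

lemma isPreconnected_closed_annulus (hn : 2 ≤ n) (a : Rn n) {s r : ℝ} (hs : 0 ≤ s) :
    IsPreconnected {z : Rn n | s ≤ dist z a ∧ dist z a ≤ r} := by
  have h := ((isPreconnected_sphere (one_lt_rank_Rn hn) (0 : Rn n) 1).prod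
    (isPreconnected_Icc (a := s) (b := r))).image (fun q : Rn n × ℝ => a + q.2 • q.1)
    (by fun_prop)
  convert h using 1
  ext z
  constructor
  · rintro ⟨h1, h2⟩
    rw [dist_eq_norm] at h1 h2
    -- The centre belongs to the set only if `s = 0`; then it is the image of any unit vector with
    -- radius `0`.
    by_cases hz : z - a = 0
    · have : Nontrivial (Rn n) := Module.nontrivial_of_finrank_pos (R := ℝ)
        (by rw [finrank_euclideanSpace_fin]; omega)
      obtain ⟨u, hu⟩ := exists_norm_eq (Rn n) (zero_le_one (α := ℝ))
      rw [hz, norm_zero] at h1 h2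
      exact ⟨(u, 0), ⟨by simpa using hu, h1, h2⟩, by simp [← sub_eq_zero.1 hz]⟩
    · refine ⟨(‖z - a‖⁻¹ • (z - a), ‖z - a‖), ⟨?_, h1, h2⟩, ?_⟩
      · simp [norm_smul, hz]
      · dsimp only
        rw [smul_smul, mul_inv_cancel₀ (norm_ne_zero_iff.2 hz)]
        simp
  · rintro ⟨⟨u, t⟩, ⟨hu, ht1, ht2⟩, rfl⟩
    have hu' : ‖u‖ = 1 := by simpa using hu
    have : dist (a + t • u) a = t := by
      rw [dist_eq_norm, add_sub_cancel_left, norm_smul, hu', mul_one, Real.norm_eq_abs,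
        abs_of_nonneg (hs.trans ht1)]
    exact ⟨by simpa [this] using ht1, by simpa [this] using ht2⟩

/-- A ring which separates the boundary of a domain lies in the domain. -/
lemma annulus_subset_of_separates (hn : 2 ≤ n) {G : Set (MobiusSpace n)} (hG : IsMobiusDomain G)
    {a : Rn n} (ha : (a : MobiusSpace n) ∈ frontier G) {s r : ℝ} (hs : 0 < s) (hsr : s ≤ r)
    (hE : ∀ z : Rn n, (z : MobiusSpace n) ∈ frontier G → s ≤ dist z a → r < dist z a)
    {q : MobiusSpace n} (hq : q ∈ frontier G) (hqr : ∀ z : Rn n, q = z → r < dist z a)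
    {z : Rn n} (hz : s ≤ dist z a) (hz' : dist z a ≤ r) : (z : MobiusSpace n) ∈ G := by
  -- `G` accumulates at `a` and at `q`, so it has points on both sides of the ring and, being
  -- connected, a point on the inner sphere. The ring is connected and misses `∂G`, so this one
  -- point puts it inside `G`.
  obtain ⟨u, ⟨u', hu', rfl⟩, hu⟩ := mem_closure_iff.1 (frontier_subset_closure ha) _
    (isOpen_coe_ball a s) ⟨a, by simpa using hs, rfl⟩
  obtain ⟨v, hv', hv⟩ := mem_closure_iff.1 (frontier_subset_closure hq) _
    (isOpen_compl_coe_closedBall a r) (by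
      rintro ⟨w, hw, rfl⟩
      exact absurd (hqr w rfl) (not_lt.2 hw))
  obtain ⟨w, hwG, hw⟩ := hG.2.isPreconnected.exists_dist_eq (a := a) (r := s) hu
    (Metric.mem_ball.1 hu').le hv (fun z hz => by
      by_contra! hlt
      exact hv' ⟨z, (hlt.le.trans hsr), hz.symm⟩)
  have hpre := (isPreconnected_closed_annulus hn a (r := r) hs.le).image
    ((↑) : Rn n → MobiusSpace n) OnePoint.continuous_coe.continuousOn
  refine hpre.subset_of_disjoint_frontier hG.1 ?_
    ⟨w, mem_image_of_mem _ (show s ≤ dist w a ∧ dist w a ≤ r from ⟨hw.ge, hw.le.trans hsr⟩), hwG⟩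
    (mem_image_of_mem _ (show s ≤ dist z a ∧ dist z a ≤ r from ⟨hz, hz'⟩))
  rintro _ ⟨x, ⟨hx1, hx2⟩, rfl⟩ hx
  exact absurd (hE x hx hx1) (not_lt.2 hx2)

end Topology

/-! ### Estimates for the absolute ratio -/

section Ratio

variable {n : ℕ}

/-- The finite points of the boundary. -/
def finiteFrontier (G : Set (MobiusSpace n)) : Set (Rn n) :=
  {z | (z : MobiusSpace n) ∈ frontier G}

lemma isClosed_finiteFrontier (G : Set (MobiusSpace n)) : IsClosed (finiteFrontier G) :=
  isClosed_frontier.preimage OnePoint.continuous_coe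

lemma finiteFrontier_nonempty {G : Set (MobiusSpace n)} (h : (frontier G).Nontrivial) :
    (finiteFrontier G).Nonempty := by
  obtain ⟨w, hw, hne⟩ := h.exists_ne OnePoint.infty
  obtain ⟨z, rfl⟩ := OnePoint.ne_infty_iff_exists.1 hne
  exact ⟨z, hw⟩

lemma infDist_finiteFrontier_pos {G : Set (MobiusSpace n)} (hG : IsMobiusDomain G)
    (h : (frontier G).Nontrivial) {x : Rn n} (hx : (x : MobiusSpace n) ∈ G) :
    0 < Metric.infDist x (finiteFrontier G) := by
  rw [← (isClosed_finiteFrontier G).notMem_iff_infDist_pos (finiteFrontier_nonempty h)]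
  intro hx'
  have : (x : MobiusSpace n) ∈ frontier G := hx'
  rw [frontier, hG.1.interior_eq] at this
  exact this.2 hx

lemma infDist_finiteFrontier_le {G : Set (MobiusSpace n)} {x z : Rn n}
    (hz : (z : MobiusSpace n) ∈ frontier G) :
    Metric.infDist x (finiteFrontier G) ≤ dist z x := by
  rw [dist_comm]
  exact Metric.infDist_le_dist_of_mem hz

/-- Here `e = |a - b|`, `d = |x - y|`, `s' = |a - x|`, `t' = |b - y|`. One of `e`, `d` is at most
`R`, and the triangle inequality bounds the other by `s' + t' + R`. The right side factors because
`1 + R (s' + t' + R) / (s' t') = (1 + R / s') (1 + R / t')`. -/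
lemma mul_div_le_of_triangle {e d s t s' t' R : ℝ} (hs : 0 < s) (ht : 0 < t) (hs' : s ≤ s')
    (ht' : t ≤ t') (he : 0 ≤ e) (hd : 0 ≤ d) (hR : R ≤ d) (h : d ≤ R ∨ e ≤ R)
    (h₁ : e ≤ s' + d + t') (h₂ : d ≤ s' + e + t') :
    1 + e * d / (s' * t') ≤ (1 + R / s) * (1 + R / t) := by
  have hR0 : 0 ≤ R := by rcases h with h | h <;> linarith
  have hs0 : 0 < s' := hs.trans_le hs'
  have ht0 : 0 < t' := ht.trans_le ht'
  have hkey : e * d ≤ R * (s' + t' + R) := by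
    rcases h with h | h
    · have : d = R := le_antisymm h hR
      subst this
      nlinarith
    · nlinarith
  calc 1 + e * d / (s' * t') ≤ 1 + R * (s' + t' + R) / (s' * t') := by gcongr
    _ = (1 + R / s') * (1 + R / t') := by field_simp; ring
    _ ≤ _ := by gcongr

/-- The absolute ratio is controlled by the distances from the points to the boundary. -/
lemma one_add_absoluteRatio_le {x y : Rn n} {a b : MobiusSpace n} {s t R : ℝ} (hs : 0 < s)
    (ht : 0 < t) (ha : ∀ z : Rn n, a = z → s ≤ dist z x) (hb : ∀ z : Rn n, b = z → t ≤ dist z y)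
    (hR : R ≤ dist x y)
    (h : dist x y ≤ R ∨ ∃ a' b' : Rn n, a = a' ∧ b = b' ∧ dist a' b' ≤ R) :
    1 + absoluteRatio a x b y ≤ (1 + R / s) * (1 + R / t) := by
  have hR0 : 0 ≤ R := by
    rcases h with h | ⟨_, _, _, _, h⟩ <;> exact dist_nonneg.trans h
  have h1 : 0 ≤ R / s := by positivity
  have h2 : 0 ≤ R / t := by positivity
  induction a using OnePoint.rec with
  | infty =>
    have hd : dist x y ≤ R := by
      rcases h with h | ⟨_, _, h, _, _⟩
      · exact h
      · exact absurd h (OnePoint.infty_ne_coe _)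
    induction b using OnePoint.rec with
    | infty =>
      have : absoluteRatio (OnePoint.infty : MobiusSpace n) x OnePoint.infty y = 0 := by
        show (0 * _) / _ = (0 : ℝ)
        simp
      rw [this]
      nlinarith
    | coe b =>
      have : absoluteRatio (OnePoint.infty : MobiusSpace n) x b y = dist x y / dist b y := by
        show (1 * dist x y) / (1 * dist b y) = _
        simp
      rw [this]
      have : dist x y / dist b y ≤ R / t := by
        have := hb b rfl
        gcongr
      nlinarith
  | coe a =>
    induction b using OnePoint.rec with
    | infty =>
      have hd : dist x y ≤ R := by
        rcases h with h | ⟨_, _, _, h, _⟩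
        · exact h
        · exact absurd h (OnePoint.infty_ne_coe _)
      have : absoluteRatio (a : MobiusSpace n) x OnePoint.infty y = dist x y / dist a x := by
        show (1 * dist x y) / (dist a x * 1) = _
        simp
      rw [this]
      have : dist x y / dist a x ≤ R / s := by
        have := ha a rfl
        gcongr
      nlinarith
    | coe b =>
      refine mul_div_le_of_triangle (e := dist a b) (d := dist x y) (s' := dist a x)
        (t' := dist b y) hs ht (ha a rfl) (hb b rfl) dist_nonneg dist_nonneg hR ?_ ?_ ?_
      · rcases h with h | ⟨a', b', ha', hb', h⟩
        · exact Or.inl h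
        · rw [OnePoint.coe_eq_coe] at ha' hb'
          subst ha' hb'
          exact Or.inr h
      · have := dist_triangle4 a x y b
        rwa [dist_comm y b] at this
      · have := dist_triangle4 x a b y
        rwa [dist_comm x a] at this

/-- Needed to bound the supremum from below by one ratio: the real `sSup` of an unbounded set would
be `0`. -/
lemma bddAbove_absoluteRatio {G : Set (MobiusSpace n)} (hG : IsMobiusDomain G)
    (h : (frontier G).Nontrivial) {x y : Rn n} (hx : (x : MobiusSpace n) ∈ G)
    (hy : (y : MobiusSpace n) ∈ G) :
    BddAbove {t : ℝ | ∃ a ∈ frontier G, ∃ b ∈ frontier G, t = absoluteRatio a x b y} := by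
  refine ⟨(1 + dist x y / Metric.infDist x (finiteFrontier G)) *
    (1 + dist x y / Metric.infDist y (finiteFrontier G)), ?_⟩
  rintro _ ⟨a, ha, b, hb, rfl⟩
  have := one_add_absoluteRatio_le (R := dist x y) (infDist_finiteFrontier_pos hG h hx)
    (infDist_finiteFrontier_pos hG h hy)
    (fun z hz => infDist_finiteFrontier_le (hz ▸ ha))
    (fun z hz => infDist_finiteFrontier_le (hz ▸ hb)) le_rfl (Or.inl le_rfl)
  linarith

lemma supAbsoluteRatio_le {G : Set (MobiusSpace n)} (h : (frontier G).Nontrivial)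
    {x y : MobiusSpace n} {m : ℝ}
    (hm : ∀ a ∈ frontier G, ∀ b ∈ frontier G, absoluteRatio a x b y ≤ m) :
    supAbsoluteRatio G x y ≤ m := by
  obtain ⟨a, ha⟩ := h.nonempty
  refine csSup_le ⟨_, a, ha, a, ha, rfl⟩ ?_
  rintro _ ⟨a, ha, b, hb, rfl⟩
  exact hm a ha b hb

lemma ratioFactor_nonneg (x y : MobiusSpace n) : 0 ≤ ratioFactor x y := by
  induction x using OnePoint.rec with
  | infty =>
    induction y using OnePoint.rec with
    | infty => exact le_rfl
    | coe y => exact zero_le_one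
  | coe x =>
    induction y using OnePoint.rec with
    | infty => exact zero_le_one
    | coe y => exact dist_nonneg

lemma supAbsoluteRatio_nonneg (G : Set (MobiusSpace n)) (x y : MobiusSpace n) :
    0 ≤ supAbsoluteRatio G x y := by
  apply Real.sSup_nonneg
  rintro _ ⟨a, _, b, _, rfl⟩
  exact div_nonneg (mul_nonneg (ratioFactor_nonneg _ _) (ratioFactor_nonneg _ _))
    (mul_nonneg (ratioFactor_nonneg _ _) (ratioFactor_nonneg _ _))

lemma mobiusMetric_le_log {G : Set (MobiusSpace n)} (h : (frontier G).Nontrivial)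
    {x y : MobiusSpace n} {m : ℝ}
    (hm : ∀ a ∈ frontier G, ∀ b ∈ frontier G, 1 + absoluteRatio a x b y ≤ m) :
    mobiusMetric G x y ≤ Real.log m := by
  have h1 := supAbsoluteRatio_le h (m := m - 1) fun a ha b hb => by linarith [hm a ha b hb]
  have h2 := supAbsoluteRatio_nonneg G x y
  exact Real.log_le_log (by linarith) (by linarith)

end Ratio

/-! ### A lower bound for the modulus metric implies uniform perfectness -/

section Converse

variable {n : ℕ}

/-- Antipodal points of a sphere in a ring separating the boundary have Möbius distance at least
`log 2`. -/
lemma log_two_le_mobiusMetric {G : Set (MobiusSpace n)} (hG : IsMobiusDomain G)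
    (hcard : (frontier G).Nontrivial) {a : Rn n} (ha : (a : MobiusSpace n) ∈ frontier G)
    {q : MobiusSpace n} (hq : q ∈ frontier G) {u : Rn n} (hu : u ≠ 0)
    (hqu : ∀ z : Rn n, q = z → ‖u‖ ≤ dist z a)
    (hx : ((a + u : Rn n) : MobiusSpace n) ∈ G) (hy : ((a - u : Rn n) : MobiusSpace n) ∈ G) :
    Real.log 2 ≤ mobiusMetric G (a + u : Rn n) (a - u : Rn n) := by
  have hu0 : 0 < ‖u‖ := norm_pos_iff.2 hu
  have hxy : dist (a + u) (a - u) = 2 * ‖u‖ := by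
    rw [dist_eq_norm, show a + u - (a - u) = (2 : ℝ) • u by rw [two_smul]; abel, norm_smul]
    simp
  have hax : dist a (a + u) = ‖u‖ := by simp
  have hay : dist a (a - u) = ‖u‖ := by simp
  -- For finite `q` the ratio is `2 |a - q| / |q - (a - u)|`, and the denominator is at most `|q -
  -- a| + |u| ≤ 2 |q - a|`; for `q = ∞` the ratio is `2`.
  have h1 : 1 ≤ absoluteRatio (a : MobiusSpace n) (a + u : Rn n) q (a - u : Rn n) := by
    induction q using OnePoint.rec with
    | infty =>
      show 1 ≤ (1 * dist (a + u) (a - u)) / (dist a (a + u) * 1)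
      rw [hxy, hax, le_div_iff₀ (by positivity)]
      linarith
    | coe b =>
      show 1 ≤ (dist a b * dist (a + u) (a - u)) / (dist a (a + u) * dist b (a - u))
      have hb := hqu b rfl
      have htri := dist_triangle b a (a - u)
      have hpos : 0 < dist b (a - u) := by
        refine dist_pos.2 fun he => ?_
        have : (b : MobiusSpace n) ∈ frontier G := hq
        rw [frontier, hG.1.interior_eq] at this
        exact this.2 (he ▸ hy)
      rw [hxy, hax, le_div_iff₀ (by positivity)]
      rw [hay] at htri
      rw [dist_comm a b]
      nlinarith
  have h2 := h1.trans (le_csSup (bddAbove_absoluteRatio hG hcard hx hy) ⟨_, ha, _, hq, rfl⟩)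
  refine Real.log_le_log two_pos ?_
  unfold supAbsoluteRatio
  linarith

theorem isUniformlyPerfect_of_le_modulusMetric (hn : 2 ≤ n) {G : Set (MobiusSpace n)}
    (hG : IsMobiusDomain G) (hcard : (frontier G).Nontrivial) {b : ℝ} (hb : 0 < b)
    (h : ∀ x ∈ G, ∀ y ∈ G, ENNReal.ofReal (b * mobiusMetric G x y) ≤ modulusMetric G x y) :
    IsUniformlyPerfect (frontier G) := by
  refine ⟨isClosed_frontier.isCompact, hcard, ?_⟩
  set V : ℝ≥0∞ := volume (Metric.ball (0 : Rn n) 1)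
  have hV : V ≠ ⊤ := measure_ball_lt_top.ne
  -- `N` is so large that the modulus bound for a ring of ratio `4 ^ N` falls below `b log 2`; the
  -- constant of uniform perfectness is then `4 ^ (-N)`.
  obtain ⟨N, hN0, hN⟩ : ∃ N : ℕ, 0 < N ∧
      ENNReal.ofReal (2 * 4 ^ n / N) * V < ENNReal.ofReal (b * Real.log 2) := by
    have hlog : 0 < b * Real.log 2 := mul_pos hb (Real.log_pos one_lt_two)
    obtain ⟨N, hN⟩ := exists_nat_gt (2 * 4 ^ n * V.toReal / (b * Real.log 2))
    have hN0 : (0 : ℝ) < N := lt_of_le_of_lt (by positivity) hN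
    refine ⟨N, by exact_mod_cast hN0, ?_⟩
    rw [← ENNReal.ofReal_toReal hV, ← ENNReal.ofReal_mul (by positivity),
      ENNReal.ofReal_lt_ofReal_iff hlog, div_mul_eq_mul_div, div_lt_iff₀ hN0]
    rw [div_lt_iff₀ hlog] at hN
    linarith
  have h4 : (4 : ℝ) ≤ 2 ^ (2 * N) := by
    calc (4 : ℝ) = 2 ^ 2 := by norm_num
      _ ≤ _ := pow_le_pow_right₀ (by norm_num) (by omega)
  refine ⟨(2 ^ (2 * N))⁻¹, by positivity, inv_lt_one_of_one_lt₀ (by linarith), ?_⟩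
  intro a ha r hr hrD
  by_contra! hno
  set s : ℝ := (2 ^ (2 * N))⁻¹ * r with hs_def
  have hs : 0 < s := by positivity
  have hrs : 2 ^ (2 * N) * s = r := by rw [hs_def]; field_simp
  have hsr : 4 * s ≤ r := by nlinarith
  -- Otherwise the empty ring confines the whole boundary to distance less than `s` from `a`, so its
  -- diameter is at most `2 s ≤ r`.
  obtain ⟨q, hq, hqr⟩ : ∃ q ∈ frontier G, ∀ z : Rn n, q = z → r < dist z a := by
    by_contra! hcon
    have hinf : OnePoint.infty ∉ frontier G := fun hinf => by
      obtain ⟨z, hz, -⟩ := hcon _ hinf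
      exact OnePoint.infty_ne_coe _ hz
    rw [euclideanDiam, if_neg hinf] at hrD
    refine absurd hrD (not_lt.2 (Metric.ediam_le fun x hx y hy => ?_))
    have key : ∀ z : Rn n, (z : MobiusSpace n) ∈ frontier G → dist z a < s := fun z hz => by
      obtain ⟨z', hz', hle⟩ := hcon _ hz
      rw [OnePoint.coe_eq_coe] at hz'
      subst hz'
      by_contra! hs'
      exact absurd (hno z hz hs') (not_lt.2 hle)
    rw [edist_dist]
    apply ENNReal.ofReal_le_ofReal
    have := dist_triangle_right x y a
    linarith [key x hx, key y hy]
  have hring : ∀ z : Rn n, s ≤ dist z a → dist z a ≤ r → (z : MobiusSpace n) ∈ G :=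
    fun z hz hz' => annulus_subset_of_separates hn hG ha hs (by linarith) hno hq hqr hz hz'
  have h2N : (1 : ℝ) ≤ 2 ^ N := one_le_pow₀ (by norm_num)
  have h2N' : (2 : ℝ) ^ N ≤ 2 ^ (2 * N) := pow_le_pow_right₀ (by norm_num) (by omega)
  have hts : s ≤ 2 ^ N * s := by nlinarith
  have htr : 2 ^ N * s ≤ r := by nlinarith
  have : Nontrivial (Rn n) := Module.nontrivial_of_finrank_pos (R := ℝ)
    (by rw [finrank_euclideanSpace_fin]; omega)
  obtain ⟨u, hu⟩ := exists_norm_eq (Rn n) (show (0 : ℝ) ≤ 2 ^ N * s by positivity)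
  have hu0 : u ≠ 0 := norm_pos_iff.1 (by rw [hu]; positivity)
  have hsph : ∀ z ∈ Metric.sphere a (2 ^ N * s), (z : MobiusSpace n) ∈ G := fun z hz => by
    rw [Metric.mem_sphere] at hz
    exact hring z (by rw [hz]; exact hts) (by rw [hz]; exact htr)
  have hxs : a + u ∈ Metric.sphere a (2 ^ N * s) := by simp [hu]
  have hys : a - u ∈ Metric.sphere a (2 ^ N * s) := by simp [hu]
  obtain ⟨p, hp⟩ := (isPathConnected_sphere (one_lt_rank_Rn hn) a
    (show (0 : ℝ) ≤ 2 ^ N * s by positivity)).joinedIn _ hxs _ hys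
  have hδ := log_two_le_mobiusMetric hG hcard ha hq hu0
    (fun z hz => by rw [hu]; exact htr.trans (hqr z hz).le) (hsph _ hxs) (hsph _ hys)
  have hμ := h _ (hsph _ hxs) _ (hsph _ hys)
  have hM : modulusMetric G (a + u : Rn n) (a - u : Rn n) ≤ ENNReal.ofReal (2 * 4 ^ n / N) * V := by
    refine (iInf₂_le (p.map OnePoint.continuous_coe) ?_).trans
      (conformalModulus_le_of_ring hn hN0 (a := a) hs ?_)
    · rintro _ ⟨t, rfl⟩
      exact hsph _ (hp t)
    · rintro γ ⟨⟨t, ht⟩, h1, -⟩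
      constructor
      · have : p t = γ 0 := OnePoint.coe_eq_coe.1 ht
        rw [← this]
        exact hp t
      · rw [hrs]
        by_contra! hcon
        exact absurd (hno (γ 1) h1 hcon.1.le) hcon.2.not_gt
  refine absurd ((ENNReal.ofReal_le_ofReal ?_).trans (hμ.trans hM)) (not_le.2 hN)
  gcongr

end Converse

/-! ### Measures on uniformly perfect sets -/

section Frostman

open Filter Topology

/-- The fair coin-tossing measure. -/
def coinMeasure : Measure (ℕ → Bool) :=
  Measure.infinitePi fun _ : ℕ => (PMF.uniformOfFintype Bool).toMeasure

instance : IsProbabilityMeasure coinMeasure := by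
  unfold coinMeasure; infer_instance

/-- `S` lies in a cylinder over `k` coordinates, so its own measurability plays no role. -/
lemma coinMeasure_le {k : ℕ} {S : Set (ℕ → Bool)}
    (hS : ∀ ω ∈ S, ∀ ω' ∈ S, ∀ i < k, ω i = ω' i) : coinMeasure S ≤ 2⁻¹ ^ k := by
  rcases S.eq_empty_or_nonempty with rfl | ⟨ω, hω⟩
  · simp
  have hsub : S ⊆ Set.pi (Finset.range k : Set ℕ) fun i => {ω i} := fun ω' hω' i hi =>
    hS ω' hω' ω hω i (by simpa using hi)
  refine (measure_mono hsub).trans ?_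
  rw [coinMeasure, Measure.infinitePi_pi _ fun _ _ => measurableSet_singleton _]
  simp

/-- Near the point `a₀` and up to the scale `r`, the set `F` meets all rings of ratio `c` centered
at points of `F`. -/
def IsThickAt {X : Type*} [MetricSpace X] (F : Set X) (c r : ℝ) (a₀ : X) : Prop :=
  a₀ ∈ F ∧ ∀ a ∈ F, dist a a₀ ≤ r → ∀ s, 0 < s → s ≤ r →
    ∃ y ∈ F, c * s ≤ dist y a ∧ dist y a ≤ s

/-- The points of a binary tree in which the second child of the point `a` on level `k` is
`sib k a` and the first one is `a` itself. -/
def treePoint {X : Type*} (sib : ℕ → X → X) (a₀ : X) : ℕ → (ℕ → Bool) → X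
  | 0, _ => a₀
  | k + 1, ω => if ω k then sib k (treePoint sib a₀ k ω) else treePoint sib a₀ k ω

lemma treePoint_congr {X : Type*} (sib : ℕ → X → X) (a₀ : X) {ω ω' : ℕ → Bool} {k : ℕ}
    (h : ∀ i < k, ω i = ω' i) : treePoint sib a₀ k ω = treePoint sib a₀ k ω' := by
  induction k with
  | zero => rfl
  | succ k ih =>
    rw [treePoint, treePoint, h k (Nat.lt_succ_self k), ih fun i hi => h i (by omega)]

lemma continuous_treePoint {X : Type*} [TopologicalSpace X] (sib : ℕ → X → X) (a₀ : X) (k : ℕ) :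
    Continuous (treePoint sib a₀ k) := by
  have hloc : IsLocallyConstant (treePoint sib a₀ k) := by
    rw [IsLocallyConstant.iff_eventually_eq]
    intro ω
    have : ∀ᶠ ω' in 𝓝 ω, ∀ i ∈ Finset.range k, ω' i = ω i := by
      rw [Filter.eventually_all_finset]
      intro i _
      have hc : ContinuousAt (fun ω' : ℕ → Bool => ω' i) ω := (continuous_apply i).continuousAt
      exact hc (IsOpen.mem_nhds (isOpen_discrete {ω i}) rfl)
    filter_upwards [this] with ω' h
    exact treePoint_congr sib a₀ fun i hi => h i (Finset.mem_range.2 hi)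
  exact hloc.continuous

/-- A thick closed set carries a probability measure with `ν (B(z, (c / 8) ^ k r)) ≤ 2 ^ (-k)`. -/
lemma IsThickAt.exists_measure {X : Type*} [MetricSpace X] [CompleteSpace X] [MeasurableSpace X]
    [BorelSpace X] {F : Set X} (hF : IsClosed F) {c r : ℝ} {a₀ : X} (hc : 0 < c)
    (hc1 : c ≤ 1) (hr : 0 < r) (h : IsThickAt F c r a₀) :
    ∃ ν : Measure X, IsProbabilityMeasure ν ∧ (∀ᵐ p ∂ν, p ∈ F ∧ dist p a₀ ≤ r) ∧
      ∀ z k, ν (Metric.ball z ((c / 8) ^ k * r)) ≤ 2⁻¹ ^ k := by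
  -- Siblings on level `k` are at least `c q ^ k r / 2` apart, and each limit point stays within `q
  -- ^ (k + 1) r` of its ancestor on level `k + 1`. With `q = c / 8` the first length is four times
  -- the second, which leaves a gap of `2 q ^ (k + 1) r`.
  set q := c / 8 with hq_def
  have hq : 0 < q := by positivity
  have hq8 : q ≤ 1 / 8 := by linarith
  have hqk : ∀ k : ℕ, 0 < q ^ k * r := fun k => by positivity
  have hqr : ∀ k : ℕ, q ^ k * r ≤ r := fun k =>
    mul_le_of_le_one_left hr.le (pow_le_one₀ hq.le (by linarith))
  have hsib : ∀ (k : ℕ) (a : X), ∃ a' : X, a ∈ F → dist a a₀ ≤ r →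
      a' ∈ F ∧ c * (q ^ k * r / 2) ≤ dist a' a ∧ dist a' a ≤ q ^ k * r / 2 := by
    intro k a
    by_cases ha : a ∈ F ∧ dist a a₀ ≤ r
    · obtain ⟨a', h1, h2⟩ := h.2 a ha.1 ha.2 (q ^ k * r / 2) (by have := hqk k; positivity)
        (by linarith [hqr k, hqk k])
      exact ⟨a', fun _ _ => ⟨h1, h2⟩⟩
    · exact ⟨a, fun h1 h2 => absurd ⟨h1, h2⟩ ha⟩
  choose sib hsib using hsib
  set T := treePoint sib a₀ with hT
  -- The reserve `q ^ k r` pays for all later moves: a move costs at most half of it, and the next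
  -- reserve is at most the other half. So the tree never leaves the ball in which `F` is known to
  -- be thick.
  have hinv : ∀ k ω, T k ω ∈ F ∧ dist (T k ω) a₀ + q ^ k * r ≤ r ∧
      dist (T (k + 1) ω) (T k ω) ≤ q ^ k * r / 2 := by
    have hstep : ∀ k ω, T k ω ∈ F → dist (T k ω) a₀ + q ^ k * r ≤ r →
        T (k + 1) ω ∈ F ∧ dist (T (k + 1) ω) (T k ω) ≤ q ^ k * r / 2 := by
      intro k ω h1 h2
      have h3 := hsib k (T k ω) h1 (by linarith [hqk k])
      have h4 := hqk k
      rw [hT, treePoint, ← hT]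
      split_ifs
      · exact ⟨h3.1, h3.2.2⟩
      · exact ⟨h1, by rw [dist_self]; positivity⟩
    intro k ω
    induction k with
    | zero =>
      have h1 : T 0 ω ∈ F := h.1
      have h2 : dist (T 0 ω) a₀ + q ^ 0 * r ≤ r := by simp [hT, treePoint]
      exact ⟨h1, h2, (hstep 0 ω h1 h2).2⟩
    | succ k ih =>
      have h1 := (hstep k ω ih.1 ih.2.1).1
      have h2 : dist (T (k + 1) ω) a₀ + q ^ (k + 1) * r ≤ r := by
        have := dist_triangle (T (k + 1) ω) (T k ω) a₀
        have h5 := hqk k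
        have : q ^ (k + 1) * r ≤ q ^ k * r / 2 := by
          rw [pow_succ]; nlinarith
        linarith [ih.2.1, ih.2.2]
      exact ⟨h1, h2, (hstep _ ω h1 h2).2⟩
  have htail : ∀ k ω m, dist (T (k + m) ω) (T k ω) + q ^ (k + m) * r ≤ q ^ k * r := by
    intro k ω m
    induction m with
    | zero => simp
    | succ m ih =>
      have h1 := dist_triangle (T (k + m + 1) ω) (T (k + m) ω) (T k ω)
      have h2 := (hinv (k + m) ω).2.2
      have h3 := hqk (k + m)
      have : q ^ (k + m + 1) * r ≤ q ^ (k + m) * r / 2 := by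
        rw [pow_succ]; nlinarith
      rw [← add_assoc]
      linarith
  have hlim : ∀ ω, ∃ p, Tendsto (fun k => T k ω) atTop (𝓝 p) := fun ω =>
    cauchySeq_tendsto_of_complete (cauchySeq_of_le_geometric q (r / 2) (by linarith) fun k => by
      rw [dist_comm]
      linarith [(hinv k ω).2.2])
  choose Φ hΦ using hlim
  have hΦd : ∀ k ω, dist (Φ ω) (T k ω) ≤ q ^ k * r := fun k ω => by
    refine le_of_tendsto ((hΦ ω).dist tendsto_const_nhds) ?_
    filter_upwards [eventually_ge_atTop k] with m hm
    obtain ⟨j, rfl⟩ := Nat.exists_eq_add_of_le hm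
    linarith [htail k ω j, hqk (k + j)]
  have hΦm : Measurable Φ := measurable_of_tendsto_metrizable
    (fun k => (continuous_treePoint sib a₀ k).measurable) (tendsto_pi_nhds.2 hΦ)
  have hsep : ∀ k ω ω', (∀ i < k, ω i = ω' i) → ω k = true → ω' k = false →
      2 * (q ^ (k + 1) * r) ≤ dist (Φ ω) (Φ ω') := by
    intro k ω ω' hag h1 h2
    have e1 : T (k + 1) ω = sib k (T k ω) := by rw [hT, treePoint, if_pos h1]
    have e2 : T (k + 1) ω' = T k ω := by
      rw [hT, treePoint, if_neg (by simp [h2])]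
      exact (treePoint_congr sib a₀ hag).symm
    have h3 := (hsib k (T k ω) (hinv k ω).1 (by linarith [(hinv k ω).2.1, hqk k])).2.1
    have h4 := hΦd (k + 1) ω
    have h5 := hΦd (k + 1) ω'
    rw [e1] at h4
    rw [e2] at h5
    have h6 := dist_triangle4 (sib k (T k ω)) (Φ ω) (Φ ω') (T k ω)
    rw [dist_comm _ (Φ ω)] at h6
    have h7 : q ^ (k + 1) * r = c * (q ^ k * r / 2) / 4 := by rw [pow_succ, hq_def]; ring
    linarith
  refine ⟨coinMeasure.map Φ, Measure.isProbabilityMeasure_map hΦm.aemeasurable, ?_, ?_⟩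
  · refine (ae_map_iff hΦm.aemeasurable
      (hF.inter (Metric.isClosed_closedBall (x := a₀) (ε := r))).measurableSet).2 ?_
    refine Eventually.of_forall fun ω => ⟨?_, ?_⟩
    · exact hF.mem_of_tendsto (hΦ ω) (Eventually.of_forall fun k => (hinv k ω).1)
    · simpa [hT, treePoint] using hΦd 0 ω
  · intro z k
    rw [Measure.map_apply hΦm Metric.isOpen_ball.measurableSet]
    refine coinMeasure_le fun ω hω ω' hω' => ?_
    have hlt : dist (Φ ω) (Φ ω') < 2 * (q ^ k * r) := by
      have := dist_triangle_right (Φ ω) (Φ ω') z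
      have h1 : dist (Φ ω) z < q ^ k * r := hω
      have h2 : dist (Φ ω') z < q ^ k * r := hω'
      linarith
    -- A first disagreement at a level `i < k` would place the two limit points at least `2 q ^ (i +
    -- 1) r ≥ 2 q ^ k r` apart, too far for one ball of radius `q ^ k r`.
    intro i
    induction i using Nat.strong_induction_on with
    | _ i ih =>
      intro hi
      have hag : ∀ j < i, ω j = ω' j := fun j hj => ih j hj (hj.trans hi)
      have hle : q ^ k * r ≤ q ^ (i + 1) * r := by
        gcongr ?_ * r
        exact pow_le_pow_of_le_one hq.le (by linarith) hi
      by_contra hne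
      rcases Bool.eq_false_or_eq_true (ω i) with h1 | h1 <;>
        rcases Bool.eq_false_or_eq_true (ω' i) with h2 | h2
      · exact hne (h1.trans h2.symm)
      · linarith [hsep i ω ω' hag h1 h2]
      · have := hsep i ω' ω (fun j hj => (hag j hj).symm) h2 h1
        rw [dist_comm] at this
        linarith
      · exact hne (h1.trans h2.symm)

/-- Split according to the shells `q ^ (k + 1) r ≤ |z - p| < q ^ k r`: the kernel is at most `(q ^
(k + 1) r) ^ (-β)` there and the mass at most `2 ^ (-k)`. The region beyond `r` gives the summand
`1`, and the point `z` itself is null. -/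
lemma lintegral_inv_dist_rpow_le {X : Type*} [MetricSpace X] [MeasurableSpace X] [BorelSpace X]
    {ν : Measure X} [IsProbabilityMeasure ν] {q r β : ℝ} (hq : 0 < q)
    (hq1 : q < 1) (hr : 0 < r) (hβ : 0 < β)
    (hν : ∀ z k, ν (Metric.ball z (q ^ k * r)) ≤ 2⁻¹ ^ k) (z : X) :
    ∫⁻ p, (ENNReal.ofReal (dist z p) ^ β)⁻¹ ∂ν ≤
      (1 + ∑' k : ℕ, 2⁻¹ ^ k * ((ENNReal.ofReal q ^ β)⁻¹) ^ (k + 1)) *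
        (ENNReal.ofReal r ^ β)⁻¹ := by
  set Q := (ENNReal.ofReal q ^ β)⁻¹ with hQ
  set W := (ENNReal.ofReal r ^ β)⁻¹ with hW
  have hmono : ∀ {u v : ℝ}, u ≤ v → (ENNReal.ofReal v ^ β)⁻¹ ≤ (ENNReal.ofReal u ^ β)⁻¹ :=
    fun huv => ENNReal.inv_le_inv.2
      (ENNReal.rpow_le_rpow (ENNReal.ofReal_le_ofReal huv) hβ.le)
  have hscale : ∀ k : ℕ, (ENNReal.ofReal (q ^ k * r) ^ β)⁻¹ = Q ^ k * W := by
    intro k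
    rw [hQ, hW, ENNReal.ofReal_mul (by positivity), ENNReal.mul_rpow_of_nonneg _ _ hβ.le,
      ENNReal.mul_inv, ENNReal.ofReal_pow hq.le, ← ENNReal.inv_pow, ← ENNReal.rpow_natCast,
      ← ENNReal.rpow_natCast, ← ENNReal.rpow_mul, ← ENNReal.rpow_mul, mul_comm β]
    · right
      exact ENNReal.rpow_ne_top_of_nonneg hβ.le ENNReal.ofReal_ne_top
    · right
      exact (ENNReal.rpow_pos (ENNReal.ofReal_pos.2 hr) ENNReal.ofReal_ne_top).ne'
  have hnull : ∀ᵐ p ∂ν, 0 < dist z p := by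
    have h0 : ν {z} = 0 := by
      refine le_antisymm (ge_of_tendsto' (ENNReal.tendsto_pow_atTop_nhds_zero_of_lt_one
        (r := 2⁻¹) (by simp)) fun k => (measure_mono ?_).trans (hν z k)) zero_le
      rw [singleton_subset_iff]
      exact Metric.mem_ball_self (by positivity)
    have : ∀ᵐ p ∂ν, p ∉ ({z} : Set X) := measure_eq_zero_iff_ae_notMem.1 h0
    filter_upwards [this] with p hp
    exact dist_pos.2 fun h => hp h.symm
  have hpt : ∀ᵐ p ∂ν, (ENNReal.ofReal (dist z p) ^ β)⁻¹ ≤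
      W + ∑' k : ℕ, (Metric.ball z (q ^ k * r)).indicator (fun _ => Q ^ (k + 1) * W) p := by
    filter_upwards [hnull] with p hp
    rcases le_or_gt r (dist z p) with hle | hlt
    · exact (hmono hle).trans le_self_add
    · have hex : ∃ m : ℕ, q ^ m * r ≤ dist z p := by
        obtain ⟨m, hm⟩ := exists_pow_lt_of_lt_one (div_pos hp hr) hq1
        exact ⟨m, ((lt_div_iff₀ hr).1 hm).le⟩
      obtain ⟨k, hk⟩ : ∃ k, Nat.find hex = k + 1 := Nat.exists_eq_succ_of_ne_zero fun h => by
        have := Nat.find_spec hex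
        rw [h, pow_zero, one_mul] at this
        exact absurd hlt (not_lt.2 this)
      have h1 : q ^ (k + 1) * r ≤ dist z p := hk ▸ Nat.find_spec hex
      have h2 : dist z p < q ^ k * r := not_le.1 (Nat.find_min hex (by omega))
      refine (hmono h1).trans (le_trans ?_ le_add_self)
      refine le_trans ?_ (ENNReal.le_tsum k)
      rw [indicator_of_mem (by rwa [Metric.mem_ball, dist_comm]), hscale]
  refine (lintegral_mono_ae hpt).trans ?_
  rw [lintegral_add_left measurable_const, lintegral_const, measure_univ, mul_one,
    lintegral_tsum fun k => (measurable_const.indicator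
      Metric.isOpen_ball.measurableSet).aemeasurable, add_mul, one_mul, ← ENNReal.tsum_mul_right]
  gcongr with k
  rw [lintegral_indicator Metric.isOpen_ball.measurableSet, setLIntegral_const, mul_comm, ← mul_assoc]
  gcongr
  exact hν z k

/-- With `Q = q ^ (-β)`, the halving of the mass beats the growth of the kernel exactly when the
geometric ratio `Q / 2` is below `1`. -/
lemma one_add_tsum_ne_top {Q : ℝ≥0∞} (hQ : Q < 2) :
    1 + ∑' k : ℕ, 2⁻¹ ^ k * Q ^ (k + 1) ≠ ⊤ := by
  have hQ' : Q ≠ ⊤ := (hQ.trans ENNReal.ofNat_lt_top).ne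
  have h1 : 2⁻¹ * Q < 1 := by
    rw [mul_comm, ← div_eq_mul_inv]
    exact ENNReal.div_lt_of_lt_mul (by simpa using hQ)
  have : ∀ k : ℕ, (2⁻¹ : ℝ≥0∞) ^ k * Q ^ (k + 1) = Q * (2⁻¹ * Q) ^ k := fun k => by
    rw [mul_pow, pow_succ]; ring
  simp_rw [this, ENNReal.tsum_mul_left, ENNReal.tsum_geometric]
  refine ENNReal.add_ne_top.2 ⟨ENNReal.one_ne_top, ENNReal.mul_ne_top hQ' ?_⟩
  exact ENNReal.inv_ne_top.2 (tsub_pos_of_lt h1).ne'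

end Frostman

/-! ### Averages of line integrals over random segments -/

section Segments

variable {n : ℕ}

/-- The line integral of `ρ` over the segment from `p` to `w`. -/
def segmentIntegral (ρ : Rn n → ℝ≥0∞) (p w : Rn n) : ℝ≥0∞ :=
  ENNReal.ofReal (dist p w) * ∫⁻ t in Ioo (0 : ℝ) 1, ρ (p + t • (w - p))

lemma lintegral_Ioo_rpow_ne_top {s : ℝ} (hs : -1 < s) :
    ∫⁻ t in Ioo (0 : ℝ) 1, ENNReal.ofReal (t ^ s) ≠ ⊤ := by
  have h := (intervalIntegral.integrableOn_Ioo_rpow_iff (s := s) one_pos).2 hs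
  exact h.lintegral_lt_top.ne

lemma lintegral_Ioi_rpow {u β : ℝ} (hu : 0 < u) (hβ : 0 < β) :
    ∫⁻ t in Ioi u, ENNReal.ofReal (t ^ (-1 - β)) = ENNReal.ofReal (u ^ (-β) / β) := by
  have h := integrableOn_Ioi_rpow_of_lt (a := -1 - β) (by linarith) hu
  rw [← ofReal_integral_eq_lintegral_ofReal h, integral_Ioi_rpow_of_lt (by linarith) hu]
  · congr 1
    rw [show -1 - β + 1 = -β by ring, neg_div_neg_eq]
  · filter_upwards [ae_restrict_mem measurableSet_Ioi] with t ht
    exact Real.rpow_nonneg (hu.trans ht).le _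

lemma lintegral_Ioo_indicator_rpow_le {d ℓ β : ℝ} (hd : 0 ≤ d) (hℓ : 0 < ℓ) (hβ : 0 < β) :
    ∫⁻ t in Ioo (0 : ℝ) 1, {t | d ≤ t * ℓ}.indicator (fun t => ENNReal.ofReal (t ^ (-1 - β))) t ≤
      ENNReal.ofReal (ℓ ^ β / β) * (ENNReal.ofReal d ^ β)⁻¹ := by
  -- For `d = 0` the right side is infinite, since `0⁻¹ = ⊤` in `ℝ≥0∞` and the other factor is
  -- positive.
  rcases hd.eq_or_lt with rfl | hd
  · have : ENNReal.ofReal (ℓ ^ β / β) ≠ 0 := (ENNReal.ofReal_pos.2 (by positivity)).ne'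
    rw [ENNReal.ofReal_zero, ENNReal.zero_rpow_of_pos hβ, ENNReal.inv_zero, ENNReal.mul_top this]
    exact le_top
  · have hset : MeasurableSet {t : ℝ | d ≤ t * ℓ} :=
      measurableSet_le measurable_const (measurable_id.mul_const ℓ)
    calc _ ≤ ∫⁻ t, {t | d ≤ t * ℓ}.indicator (fun t => ENNReal.ofReal (t ^ (-1 - β))) t :=
          setLIntegral_le_lintegral _ _
      _ = ∫⁻ t in Ici (d / ℓ), ENNReal.ofReal (t ^ (-1 - β)) := by
          rw [lintegral_indicator hset]
          congr 2
          ext t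
          exact (div_le_iff₀ hℓ).symm
      _ = ENNReal.ofReal ((d / ℓ) ^ (-β) / β) := by
          rw [setLIntegral_congr Ioi_ae_eq_Ici.symm, lintegral_Ioi_rpow (by positivity) hβ]
      _ = _ := by
          rw [ENNReal.ofReal_rpow_of_pos hd, ← ENNReal.ofReal_inv_of_pos (by positivity),
            ← ENNReal.ofReal_mul (by positivity), Real.rpow_neg (by positivity),
            Real.div_rpow hd.le hℓ.le]
          congr 1
          field_simp

lemma lintegral_comp_homothety {f : Rn n → ℝ≥0∞} (hf : Measurable f) (p : Rn n) {t : ℝ}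
    (ht : 0 < t) :
    ∫⁻ w, f (p + t • (w - p)) = ENNReal.ofReal ((t ^ n)⁻¹) * ∫⁻ z, f z := by
  have h1 : ∫⁻ w, f (p + t • (w - p)) = ∫⁻ w, f (p + t • w) :=
    lintegral_sub_right_eq_self (fun w => f (p + t • w)) p
  have h2 : ∫⁻ z, f z = ∫⁻ z, f (p + z) := (lintegral_add_left_eq_self f p).symm
  have h3 := Measure.map_addHaar_smul (volume : Measure (Rn n)) ht.ne'
  have h4 : ∫⁻ w, f (p + t • w) = ∫⁻ z, f (p + z) ∂(Measure.map (t • ·) volume) :=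
    (lintegral_map (hf.comp (measurable_const_add p)) (measurable_const_smul t)).symm
  rw [h1, h2, h4, h3, lintegral_smul_measure, finrank_euclideanSpace_fin,
    abs_of_pos (by positivity), smul_eq_mul]

lemma setLIntegral_comp_homothety_le {f : Rn n → ℝ≥0∞} (hf : Measurable f) (p : Rn n) {t ℓ : ℝ}
    (ht : 0 < t) {B : Set (Rn n)} (hB : MeasurableSet B) (hBℓ : ∀ w ∈ B, dist p w ≤ ℓ) :
    ∫⁻ w in B, f (p + t • (w - p)) ≤
      ENNReal.ofReal ((t ^ n)⁻¹) * ∫⁻ z, {z | dist z p ≤ t * ℓ}.indicator f z := by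
  have hS : MeasurableSet {z : Rn n | dist z p ≤ t * ℓ} := Metric.isClosed_closedBall.measurableSet
  rw [← lintegral_comp_homothety (hf.indicator hS) p ht]
  refine le_trans (le_of_eq ?_) (setLIntegral_le_lintegral B _)
  refine setLIntegral_congr_fun hB fun w hw => ?_
  rw [indicator_of_mem]
  have : dist (p + t • (w - p)) p = t * dist p w := by
    rw [dist_eq_norm, add_sub_cancel_left, norm_smul, Real.norm_of_nonneg ht.le, dist_comm,
      dist_eq_norm]
  rw [mem_ofPred_eq, this]
  exact mul_le_mul_of_nonneg_left (hBℓ w hw) ht.le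

/-- For fixed `t` substitute `z = p + t (w - p)`, with Jacobian `t ^ (-n)`. Only `t ≥ |z - p| / ℓ`
can reach `z`, and after Tonelli the integral of `t ^ (-1 - β)` over these `t` produces the kernel.
-/
lemma lintegral_weighted_cone_le {f : Rn n → ℝ≥0∞} (hf : Measurable f) (p : Rn n) {ℓ β : ℝ}
    (hℓ : 0 < ℓ) (hβ : 0 < β) {B : Set (Rn n)} (hB : MeasurableSet B)
    (hBℓ : ∀ w ∈ B, dist p w ≤ ℓ) :
    ∫⁻ t in Ioo (0 : ℝ) 1, ENNReal.ofReal (t ^ ((n : ℝ) - 1 - β)) *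
        ∫⁻ w in B, f (p + t • (w - p)) ≤
      ENNReal.ofReal (ℓ ^ β / β) * ∫⁻ z, f z * (ENNReal.ofReal (dist z p) ^ β)⁻¹ := by
  let F : ℝ → Rn n → ℝ≥0∞ := fun t z =>
    f z * {t | dist z p ≤ t * ℓ}.indicator (fun t => ENNReal.ofReal (t ^ (-1 - β))) t
  have hFm : Measurable (Function.uncurry F) := by
    have hset : MeasurableSet {q : ℝ × Rn n | dist q.2 p ≤ q.1 * ℓ} :=
      measurableSet_le (by fun_prop) (by fun_prop)
    have : Function.uncurry F = fun q : ℝ × Rn n => f q.2 *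
        {q : ℝ × Rn n | dist q.2 p ≤ q.1 * ℓ}.indicator
          (fun q => ENNReal.ofReal (q.1 ^ (-1 - β))) q := by
      ext ⟨t, z⟩
      rfl
    rw [this]
    refine (hf.comp measurable_snd).mul (Measurable.indicator ?_ hset)
    fun_prop
  calc _ ≤ ∫⁻ t in Ioo (0 : ℝ) 1, ∫⁻ z, F t z := by
        refine setLIntegral_mono' measurableSet_Ioo fun t ht => ?_
        have ht0 : 0 < t := ht.1
        have h1 := setLIntegral_comp_homothety_le hf p ht0 hB hBℓ
        calc _ ≤ ENNReal.ofReal (t ^ ((n : ℝ) - 1 - β)) * (ENNReal.ofReal ((t ^ n)⁻¹) *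
              ∫⁻ z, {z | dist z p ≤ t * ℓ}.indicator f z) := by gcongr
          _ = ENNReal.ofReal (t ^ (-1 - β)) *
              ∫⁻ z, {z | dist z p ≤ t * ℓ}.indicator f z := by
              rw [← mul_assoc, ← ENNReal.ofReal_mul (by positivity), ← Real.rpow_natCast,
                ← Real.rpow_neg ht0.le, ← Real.rpow_add ht0]
              congr 3
              ring
          _ = ∫⁻ z, F t z := by
              rw [← lintegral_const_mul' _ _ ENNReal.ofReal_ne_top]
              refine lintegral_congr fun z => ?_
              by_cases hz : dist z p ≤ t * ℓ
              · simp only [F, indicator, mem_ofPred_eq, hz, if_true]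
                exact mul_comm _ _
              · simp only [F, indicator, mem_ofPred_eq, hz, if_false, mul_zero]
    _ = ∫⁻ z, ∫⁻ t in Ioo (0 : ℝ) 1, F t z := lintegral_lintegral_swap hFm.aemeasurable
    _ ≤ ∫⁻ z, ENNReal.ofReal (ℓ ^ β / β) * (f z * (ENNReal.ofReal (dist z p) ^ β)⁻¹) := by
        refine lintegral_mono fun z => ?_
        have hm : Measurable ({t | dist z p ≤ t * ℓ}.indicator
            fun t : ℝ => ENNReal.ofReal (t ^ (-1 - β))) :=
          Measurable.indicator (by fun_prop)
            (measurableSet_le measurable_const (measurable_id.mul_const ℓ))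
        dsimp only [F]
        rw [lintegral_const_mul _ hm]
        calc _ ≤ f z * (ENNReal.ofReal (ℓ ^ β / β) * (ENNReal.ofReal (dist z p) ^ β)⁻¹) := by
              gcongr
              exact lintegral_Ioo_indicator_rpow_le dist_nonneg hℓ hβ
          _ = _ := by ring
    _ = _ := lintegral_const_mul' _ _ ENNReal.ofReal_ne_top

/-- Hölder's inequality with exponents `n` and `n / (n - 1)` for `g = (g θ) · θ⁻¹`. -/
lemma pow_lintegral_le_of_weight {α : Type*} [MeasurableSpace α] {μ : Measure α} (hn : 2 ≤ n)
    {g θ : α → ℝ≥0∞} (hg : Measurable g) (hθ : Measurable θ) (hθ0 : ∀ᵐ x ∂μ, θ x ≠ 0)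
    (hθt : ∀ᵐ x ∂μ, θ x ≠ ⊤) :
    (∫⁻ x, g x ∂μ) ^ n ≤ (∫⁻ x, g x ^ n * θ x ^ n ∂μ) *
      (∫⁻ x, (θ x)⁻¹ ^ ((n : ℝ) / ((n : ℝ) - 1)) ∂μ) ^ (n - 1) := by
  have hn1 : (1 : ℝ) < n := by exact_mod_cast hn
  have hpq : (n : ℝ).HolderConjugate ((n : ℝ) / ((n : ℝ) - 1)) := Real.HolderConjugate.conjExponent hn1
  have h := ENNReal.lintegral_mul_le_Lp_mul_Lq μ hpq (f := fun x => g x * θ x)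
    (g := fun x => (θ x)⁻¹) (hg.mul hθ).aemeasurable hθ.inv.aemeasurable
  have heq : ∫⁻ x, g x ∂μ = ∫⁻ x, ((fun x => g x * θ x) * fun x => (θ x)⁻¹) x ∂μ := by
    refine lintegral_congr_ae ?_
    filter_upwards [hθ0, hθt] with x h0 ht
    simp only [Pi.mul_apply]
    rw [mul_assoc, ENNReal.mul_inv_cancel h0 ht, mul_one]
  rw [heq]
  refine (pow_le_pow_left' h n).trans (le_of_eq ?_)
  rw [mul_pow, ← ENNReal.rpow_natCast, ← ENNReal.rpow_mul, ← ENNReal.rpow_natCast,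
    ← ENNReal.rpow_mul, ← ENNReal.rpow_natCast]
  congr 1
  · rw [one_div, inv_mul_cancel₀ (by positivity), ENNReal.rpow_one]
    refine lintegral_congr fun x => ?_
    rw [ENNReal.rpow_natCast, mul_pow]
  · congr 1
    rw [Nat.cast_sub (by omega), Nat.cast_one]
    have : (n : ℝ) - 1 ≠ 0 := by linarith
    field_simp

/-- The average of the line integrals over the segments joining a `ν`-random point to a random
point of `B` is controlled by the `L ^ n` norm. -/
lemma pow_lintegral_cone_le (hn : 2 ≤ n) {ρ : Rn n → ℝ≥0∞} (hρ : Measurable ρ)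
    {ν : Measure (Rn n)} [IsProbabilityMeasure ν] {ℓ β : ℝ} (hℓ : 0 < ℓ) (hβ : 0 < β)
    {B : Set (Rn n)} (hB : MeasurableSet B)
    (hBℓ : ∀ᵐ p ∂ν, ∀ w ∈ B, dist p w ≤ ℓ) {K : ℝ≥0∞}
    (hK : ∀ z, ∫⁻ p, (ENNReal.ofReal (dist z p) ^ β)⁻¹ ∂ν ≤ K) :
    (∫⁻ p, (∫⁻ w in B, ∫⁻ t in Ioo (0 : ℝ) 1, ρ (p + t • (w - p))) ∂ν) ^ n ≤
      ENNReal.ofReal (ℓ ^ β / β) * K * (∫⁻ z, ρ z ^ n) *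
      ((∫⁻ t in Ioo (0 : ℝ) 1, ENNReal.ofReal (t ^ (β / ((n : ℝ) - 1) - 1))) * volume B) ^ (n - 1) := by
  have hn1 : (1 : ℝ) < n := by exact_mod_cast hn
  have hn0 : (n : ℝ) - 1 ≠ 0 := by linarith
  set μB := (volume : Measure (Rn n)).restrict B
  set μI := (volume : Measure ℝ).restrict (Ioo (0 : ℝ) 1)
  let M := ν.prod (μB.prod μI)
  let g : Rn n × Rn n × ℝ → ℝ≥0∞ := fun x => ρ (x.1 + x.2.2 • (x.2.1 - x.1))
  -- The weight satisfies `θ ^ n = t ^ (n - 1 - β)`, as the cone estimate requires, while `θ ^ (-n /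
  -- (n - 1)) = t ^ (β / (n - 1) - 1)` is integrable at `0` because `β > 0`.
  let θ : Rn n × Rn n × ℝ → ℝ≥0∞ := fun x => ENNReal.ofReal (x.2.2 ^ (((n : ℝ) - 1 - β) / n))
  have hg : Measurable g := hρ.comp (by fun_prop)
  have hθ : Measurable θ := by fun_prop
  have hpos : ∀ᵐ x ∂M, 0 < x.2.2 := by
    have h1 : ∀ᵐ t ∂μI, (0 : ℝ) < t := by
      filter_upwards [ae_restrict_mem measurableSet_Ioo] with t ht using ht.1
    have h2 : ∀ᵐ y ∂(μB.prod μI), 0 < y.2 := Measure.quasiMeasurePreserving_snd.ae h1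
    exact Measure.quasiMeasurePreserving_snd.ae h2
  have hhold := pow_lintegral_le_of_weight (μ := M) hn hg hθ
    (by filter_upwards [hpos] with x hx using (ENNReal.ofReal_pos.2 (Real.rpow_pos_of_pos hx _)).ne')
    (Filter.Eventually.of_forall fun x => ENNReal.ofReal_ne_top)
  have hL : ∫⁻ x, g x ∂M = ∫⁻ p, (∫⁻ w in B, ∫⁻ t in Ioo (0 : ℝ) 1, ρ (p + t • (w - p))) ∂ν := by
    rw [lintegral_prod _ hg.aemeasurable]
    refine lintegral_congr fun p => ?_
    rw [lintegral_prod _ (by fun_prop)]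
  have h2 : ∫⁻ x, (θ x)⁻¹ ^ ((n : ℝ) / ((n : ℝ) - 1)) ∂M =
      (∫⁻ t in Ioo (0 : ℝ) 1, ENNReal.ofReal (t ^ (β / ((n : ℝ) - 1) - 1))) * volume B := by
    have : ∫⁻ x, (θ x)⁻¹ ^ ((n : ℝ) / ((n : ℝ) - 1)) ∂M =
        ∫⁻ x, ENNReal.ofReal (x.2.2 ^ (β / ((n : ℝ) - 1) - 1)) ∂M := by
      refine lintegral_congr_ae ?_
      filter_upwards [hpos] with x hx
      dsimp only [θ]
      rw [← ENNReal.ofReal_inv_of_pos (Real.rpow_pos_of_pos hx _),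
        ENNReal.ofReal_rpow_of_pos (by positivity), ← Real.rpow_neg hx.le, ← Real.rpow_mul hx.le]
      congr 2
      field_simp
      ring
    rw [this, lintegral_prod _ (by fun_prop)]
    simp_rw [lintegral_prod (μ := μB) (ν := μI) (fun y : Rn n × ℝ =>
      ENNReal.ofReal (y.2 ^ (β / ((n : ℝ) - 1) - 1))) (by fun_prop)]
    simp [μB, μI]
  have h1 : ∫⁻ x, g x ^ n * θ x ^ n ∂M ≤
      ENNReal.ofReal (ℓ ^ β / β) * K * (∫⁻ z, ρ z ^ n) := by
    calc _ = ∫⁻ p, (∫⁻ t in Ioo (0 : ℝ) 1, ENNReal.ofReal (t ^ ((n : ℝ) - 1 - β)) *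
          ∫⁻ w in B, ρ (p + t • (w - p)) ^ n) ∂ν := by
          rw [lintegral_prod _ (by fun_prop)]
          refine lintegral_congr fun p => ?_
          rw [lintegral_prod_symm _ (by fun_prop)]
          refine setLIntegral_congr_fun measurableSet_Ioo fun t ht => ?_
          rw [← lintegral_const_mul' _ _ ENNReal.ofReal_ne_top]
          refine lintegral_congr fun w => ?_
          dsimp only [g, θ]
          rw [mul_comm, ← ENNReal.ofReal_pow (Real.rpow_nonneg ht.1.le _), ← Real.rpow_natCast,
            ← Real.rpow_mul ht.1.le, div_mul_cancel₀ _ (by positivity)]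
      _ ≤ ∫⁻ p, ENNReal.ofReal (ℓ ^ β / β) *
          (∫⁻ z, ρ z ^ n * (ENNReal.ofReal (dist z p) ^ β)⁻¹) ∂ν := by
          refine lintegral_mono_ae ?_
          filter_upwards [hBℓ] with p hp
          exact lintegral_weighted_cone_le (hρ.pow_const n) p hℓ hβ hB hp
      _ = ENNReal.ofReal (ℓ ^ β / β) *
          ∫⁻ z, ρ z ^ n * ∫⁻ p, (ENNReal.ofReal (dist z p) ^ β)⁻¹ ∂ν := by
          rw [lintegral_const_mul' _ _ ENNReal.ofReal_ne_top, lintegral_lintegral_swap (by fun_prop)]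
          congr 1
          refine lintegral_congr fun z => ?_
          rw [lintegral_const_mul _ (by fun_prop)]
      _ ≤ ENNReal.ofReal (ℓ ^ β / β) * ∫⁻ z, ρ z ^ n * K := by
          gcongr with z
          exact hK z
      _ = _ := by
          rw [lintegral_mul_const _ (hρ.pow_const n)]
          ring
  rw [hL, h2] at hhold
  refine hhold.trans ?_
  gcongr

end Segments

/-! ### The energy estimate for curves joining two thick sets -/

section TwoSets

variable {n : ℕ}

lemma measurable_segmentIntegral {ρ : Rn n → ℝ≥0∞} (hρ : Measurable ρ) (p : Rn n) :
    Measurable (segmentIntegral ρ p) := by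
  unfold segmentIntegral
  refine Measurable.mul (by fun_prop) ?_
  exact Measurable.lintegral_prod_right'
    (f := fun x : Rn n × ℝ => ρ (p + x.2 • (x.1 - p))) (hρ.comp (by fun_prop))

lemma pow_lintegral_segmentIntegral_le (hn : 2 ≤ n) {ρ : Rn n → ℝ≥0∞} (hρ : Measurable ρ)
    {ν : Measure (Rn n)} [IsProbabilityMeasure ν] {ℓ β : ℝ} (hℓ : 0 < ℓ) (hβ : 0 < β)
    {B : Set (Rn n)} (hB : MeasurableSet B)
    (hBℓ : ∀ᵐ p ∂ν, ∀ w ∈ B, dist p w ≤ ℓ) {K : ℝ≥0∞}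
    (hK : ∀ z, ∫⁻ p, (ENNReal.ofReal (dist z p) ^ β)⁻¹ ∂ν ≤ K) :
    (∫⁻ p, (∫⁻ w in B, segmentIntegral ρ p w) ∂ν) ^ n ≤
      ENNReal.ofReal ℓ ^ n * (ENNReal.ofReal (ℓ ^ β / β) * K * (∫⁻ z, ρ z ^ n) *
      ((∫⁻ t in Ioo (0 : ℝ) 1, ENNReal.ofReal (t ^ (β / ((n : ℝ) - 1) - 1))) *
        volume B) ^ (n - 1)) := by
  calc _ ≤ (∫⁻ p, ENNReal.ofReal ℓ *
        (∫⁻ w in B, ∫⁻ t in Ioo (0 : ℝ) 1, ρ (p + t • (w - p))) ∂ν) ^ n := by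
        refine pow_le_pow_left' (lintegral_mono_ae ?_) n
        filter_upwards [hBℓ] with p hp
        rw [← lintegral_const_mul' _ _ ENNReal.ofReal_ne_top]
        refine setLIntegral_mono' hB fun w hw => ?_
        unfold segmentIntegral
        gcongr
        exact hp w hw
    _ = ENNReal.ofReal ℓ ^ n *
        (∫⁻ p, (∫⁻ w in B, ∫⁻ t in Ioo (0 : ℝ) 1, ρ (p + t • (w - p))) ∂ν) ^ n := by
        rw [lintegral_const_mul' _ _ ENNReal.ofReal_ne_top, mul_pow]
    _ ≤ _ := by
        gcongr
        exact pow_lintegral_cone_le hn hρ hℓ hβ hB hBℓ hK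

/-- Average the hypothesis over `w`, then `p`, then `q`. At each stage one summand is constant or
measurable in `w`, so no measurability in the endpoints is needed. -/
lemma volume_le_lintegral_add {ρ : Rn n → ℝ≥0∞} (hρ : Measurable ρ) {ν₁ ν₂ : Measure (Rn n)}
    [IsProbabilityMeasure ν₁] [IsProbabilityMeasure ν₂] {B : Set (Rn n)} (hB : MeasurableSet B)
    (h : ∀ᵐ q ∂ν₂, ∀ᵐ p ∂ν₁, ∀ w ∈ B, 1 ≤ segmentIntegral ρ p w + segmentIntegral ρ q w) :
    volume B ≤ (∫⁻ p, (∫⁻ w in B, segmentIntegral ρ p w) ∂ν₁) +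
      ∫⁻ q, (∫⁻ w in B, segmentIntegral ρ q w) ∂ν₂ := by
  have h1 : ∀ᵐ q ∂ν₂, volume B ≤ (∫⁻ p, (∫⁻ w in B, segmentIntegral ρ p w) ∂ν₁) +
      ∫⁻ w in B, segmentIntegral ρ q w := by
    filter_upwards [h] with q hq
    calc volume B = ∫⁻ _, volume B ∂ν₁ := by simp
      _ ≤ ∫⁻ p, ((∫⁻ w in B, segmentIntegral ρ p w) + ∫⁻ w in B, segmentIntegral ρ q w) ∂ν₁ := by
          refine lintegral_mono_ae ?_
          filter_upwards [hq] with p hp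
          rw [← lintegral_add_left (measurable_segmentIntegral hρ p), ← setLIntegral_one]
          exact setLIntegral_mono' hB hp
      _ = _ := by
          rw [lintegral_add_right _ measurable_const]
          simp
  calc volume B = ∫⁻ _, volume B ∂ν₂ := by simp
    _ ≤ ∫⁻ q, ((∫⁻ p, (∫⁻ w in B, segmentIntegral ρ p w) ∂ν₁) +
        ∫⁻ w in B, segmentIntegral ρ q w) ∂ν₂ := lintegral_mono_ae h1
    _ = _ := by
        rw [lintegral_add_left measurable_const]
        simp

/-- One of `X₁`, `X₂` is at least `V / 2`; insert this into its bound and cancel `V ^ (n - 1)`. -/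
lemma le_mul_lintegral_of_le_add {V Λ' ℓ' τ' Y J m X₁ X₂ : ℝ≥0∞} (hn : 2 ≤ n) (hV0 : V ≠ 0)
    (hVt : V ≠ ⊤) (hX : V ≤ X₁ + X₂) (h₁ : X₁ ^ n ≤ ℓ' ^ n * (Y * m * (J * V) ^ (n - 1)))
    (h₂ : X₂ ^ n ≤ ℓ' ^ n * (Y * m * (J * V) ^ (n - 1))) (hℓ : ℓ' ≤ Λ' * τ') :
    V ≤ (2 * Λ' * τ') ^ n * (Y * m * J ^ (n - 1)) := by
  have hmax : V ≤ 2 * max X₁ X₂ := by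
    rw [two_mul]
    exact hX.trans (add_le_add (le_max_left _ _) (le_max_right _ _))
  have hm : max X₁ X₂ ^ n ≤ ℓ' ^ n * (Y * m * (J * V) ^ (n - 1)) := by
    rcases max_choice X₁ X₂ with h | h <;> rw [h] <;> assumption
  have key : V * V ^ (n - 1) ≤ ((2 * Λ' * τ') ^ n * (Y * m * J ^ (n - 1))) * V ^ (n - 1) := by
    calc V * V ^ (n - 1) = V ^ n := by rw [← pow_succ']; congr 1; omega
      _ ≤ (2 * max X₁ X₂) ^ n := pow_le_pow_left' hmax n
      _ = 2 ^ n * max X₁ X₂ ^ n := mul_pow _ _ _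
      _ ≤ 2 ^ n * ((Λ' * τ') ^ n * (Y * m * (J * V) ^ (n - 1))) := by
          gcongr
          exact hm.trans (by gcongr)
      _ = _ := by
          rw [mul_pow J V, mul_assoc 2, mul_pow 2]
          ring
  exact (ENNReal.mul_le_mul_iff_left (pow_ne_zero _ hV0) (ENNReal.pow_ne_top hVt)).1 key

/-- If `ρ` is admissible for the two-segment curves joining two sets which are thick at scale `r`,
then the `L ^ n` norm of `ρ` is bounded below. -/
lemma exists_lower_bound_of_thick (hn : 2 ≤ n) {c β : ℝ} (hc : 0 < c) (hc1 : c ≤ 1) (hβ : 0 < β)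
    (hQ : (ENNReal.ofReal (c / 8) ^ β)⁻¹ < 2) (Λ : ℝ) :
    ∃ κ : ℝ, 0 < κ ∧ ∀ (F₁ F₂ : Set (Rn n)) (p₀ q₀ w₀ : Rn n) (r τ ℓ : ℝ) (ρ : Rn n → ℝ≥0∞),
      IsClosed F₁ → IsClosed F₂ → 0 < r → 0 < τ → 0 < ℓ → ℓ ≤ Λ * τ →
      IsThickAt F₁ c r p₀ → IsThickAt F₂ c r q₀ → Measurable ρ →
      (∀ p ∈ Metric.closedBall p₀ r, ∀ w ∈ Metric.ball w₀ τ, dist p w ≤ ℓ) →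
      (∀ q ∈ Metric.closedBall q₀ r, ∀ w ∈ Metric.ball w₀ τ, dist q w ≤ ℓ) →
      (∀ p ∈ F₁ ∩ Metric.closedBall p₀ r, ∀ q ∈ F₂ ∩ Metric.closedBall q₀ r,
        ∀ w ∈ Metric.ball w₀ τ, 1 ≤ segmentIntegral ρ p w + segmentIntegral ρ q w) →
      ENNReal.ofReal (κ * (r / ℓ) ^ β) ≤ ∫⁻ z, ρ z ^ n := by
  set A : ℝ≥0∞ := 1 + ∑' k : ℕ, 2⁻¹ ^ k * ((ENNReal.ofReal (c / 8) ^ β)⁻¹) ^ (k + 1) with hA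
  have hAt : A ≠ ⊤ := one_add_tsum_ne_top hQ
  set J : ℝ≥0∞ := ∫⁻ t in Ioo (0 : ℝ) 1, ENNReal.ofReal (t ^ (β / ((n : ℝ) - 1) - 1)) with hJ
  have hn1 : (1 : ℝ) < n := by exact_mod_cast hn
  have hJt : J ≠ ⊤ := lintegral_Ioo_rpow_ne_top (by
    have : 0 < β / ((n : ℝ) - 1) := div_pos hβ (by linarith)
    linarith)
  set Ω : ℝ≥0∞ := volume (Metric.ball (0 : Rn n) 1)
  have hΩ0 : Ω ≠ 0 := (Metric.measure_ball_pos _ _ one_pos).ne'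
  have hΩt : Ω ≠ ⊤ := measure_ball_lt_top.ne
  -- The summand `1` keeps `C` nonzero, so that `κ = Ω / C` is finite.
  set C : ℝ≥0∞ := (2 * ENNReal.ofReal Λ) ^ n * (ENNReal.ofReal (1 / β) * A * J ^ (n - 1)) + 1
    with hC
  have hCt : C ≠ ⊤ := ENNReal.add_ne_top.2 ⟨ENNReal.mul_ne_top (ENNReal.pow_ne_top
    (ENNReal.mul_ne_top ENNReal.ofNat_ne_top ENNReal.ofReal_ne_top)) (ENNReal.mul_ne_top
    (ENNReal.mul_ne_top ENNReal.ofReal_ne_top hAt) (ENNReal.pow_ne_top hJt)), ENNReal.one_ne_top⟩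
  have hC0 : C ≠ 0 := by simp [hC]
  have hκt : Ω / C ≠ ⊤ := ENNReal.div_ne_top hΩt hC0
  refine ⟨(Ω / C).toReal, ENNReal.toReal_pos (ENNReal.div_pos hΩ0 hCt).ne' hκt, ?_⟩
  intro F₁ F₂ p₀ q₀ w₀ r τ ℓ ρ hF₁ hF₂ hr hτ hℓ hℓΛ hT₁ hT₂ hρ hd₁ hd₂ hadm
  obtain ⟨ν₁, hν₁, hs₁, hb₁⟩ := hT₁.exists_measure hF₁ hc hc1 hr
  obtain ⟨ν₂, hν₂, hs₂, hb₂⟩ := hT₂.exists_measure hF₂ hc hc1 hr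
  have hK₁ := lintegral_inv_dist_rpow_le (by positivity) (by linarith) hr hβ hb₁
  have hK₂ := lintegral_inv_dist_rpow_le (by positivity) (by linarith) hr hβ hb₂
  have hX := volume_le_lintegral_add (ν₁ := ν₁) (ν₂ := ν₂) hρ
    (Metric.isOpen_ball (x := w₀) (ε := τ)).measurableSet (by
      filter_upwards [hs₂] with q hq
      filter_upwards [hs₁] with p hp
      exact hadm p hp q hq)
  have h₁ := pow_lintegral_segmentIntegral_le (ν := ν₁) hn hρ hℓ hβ
    (Metric.isOpen_ball (x := w₀) (ε := τ)).measurableSet (by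
      filter_upwards [hs₁] with p hp using hd₁ p hp.2) hK₁
  have h₂ := pow_lintegral_segmentIntegral_le (ν := ν₂) hn hρ hℓ hβ
    (Metric.isOpen_ball (x := w₀) (ε := τ)).measurableSet (by
      filter_upwards [hs₂] with p hp using hd₂ p hp.2) hK₂
  rw [← hJ, ← hA] at h₁ h₂
  have hV : volume (Metric.ball w₀ τ) = ENNReal.ofReal τ ^ n * Ω := by
    rw [Measure.addHaar_ball_of_pos _ _ hτ, finrank_euclideanSpace_fin, ENNReal.ofReal_pow hτ.le]
  have hτ0 : ENNReal.ofReal τ ^ n ≠ 0 := pow_ne_zero _ (ENNReal.ofReal_pos.2 hτ).ne'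
  have hτt : ENNReal.ofReal τ ^ n ≠ ⊤ := ENNReal.pow_ne_top ENNReal.ofReal_ne_top
  have hΛ : 0 ≤ Λ := by
    by_contra! hneg
    nlinarith
  have hmain := le_mul_lintegral_of_le_add (Λ' := ENNReal.ofReal Λ) (τ' := ENNReal.ofReal τ) hn
    (by rw [hV]; exact mul_ne_zero hτ0 hΩ0) (by rw [hV]; exact ENNReal.mul_ne_top hτt hΩt) hX h₁ h₂
    (by rw [← ENNReal.ofReal_mul hΛ]; exact ENNReal.ofReal_le_ofReal hℓΛ)
  have hx : 0 < (ℓ / r) ^ β := by positivity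
  have hscale : ENNReal.ofReal (ℓ ^ β / β) * (A * (ENNReal.ofReal r ^ β)⁻¹) =
      ENNReal.ofReal (1 / β) * A * ENNReal.ofReal ((ℓ / r) ^ β) := by
    rw [ENNReal.ofReal_rpow_of_pos hr, ← ENNReal.ofReal_inv_of_pos (by positivity),
      mul_comm A, ← mul_assoc, ← ENNReal.ofReal_mul (by positivity), mul_right_comm,
      ← ENNReal.ofReal_mul (by positivity), Real.div_rpow hℓ.le hr.le]
    congr 2
    field_simp
  -- The factor `τ ^ n` from the volume of the ball cancels against `ℓ ^ n ≤ (Λ τ) ^ n`, which makes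
  -- the estimate scale invariant.
  have hfin : Ω ≤ C * (ENNReal.ofReal ((ℓ / r) ^ β) * ∫⁻ z, ρ z ^ n) := by
    rw [hV, hscale] at hmain
    have : ENNReal.ofReal τ ^ n * Ω ≤ ENNReal.ofReal τ ^ n *
        (((2 * ENNReal.ofReal Λ) ^ n * (ENNReal.ofReal (1 / β) * A * J ^ (n - 1))) *
          (ENNReal.ofReal ((ℓ / r) ^ β) * ∫⁻ z, ρ z ^ n)) := by
      refine hmain.trans (le_of_eq ?_)
      rw [mul_pow _ (ENNReal.ofReal τ)]
      ring
    refine ((ENNReal.mul_le_mul_iff_right hτ0 hτt).1 this).trans ?_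
    gcongr
    exact le_self_add
  rw [ENNReal.ofReal_mul ENNReal.toReal_nonneg, ENNReal.ofReal_toReal hκt]
  have hinv : ENNReal.ofReal ((r / ℓ) ^ β) = (ENNReal.ofReal ((ℓ / r) ^ β))⁻¹ := by
    rw [← ENNReal.ofReal_inv_of_pos hx, ← Real.inv_rpow (by positivity), inv_div]
  rw [hinv, ← div_eq_mul_inv]
  refine ENNReal.div_le_of_le_mul ?_
  refine ENNReal.div_le_of_le_mul ?_
  rw [mul_comm] at hfin
  rwa [mul_comm (∫⁻ z, ρ z ^ n)]

end TwoSets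

/-! ### Polygonal curves -/

section Polygons

variable {n : ℕ}

lemma hasUnitSpeedOn_of_isometry {f : ℝ → Rn n} {a b : ℝ}
    (hf : ∀ s ∈ Icc a b, ∀ t ∈ Icc a b, dist (f s) (f t) = dist s t) :
    HasUnitSpeedOn f (Icc a b) := by
  unfold HasUnitSpeedOn
  rw [hasConstantSpeedOnWith_iff_ordered]
  intro x hx y hy hxy
  have hset : Icc a b ∩ Icc x y = Icc x y :=
    inter_eq_right.2 (Icc_subset_Icc hx.1 hy.2)
  rw [hset, NNReal.coe_one, one_mul]
  apply le_antisymm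
  · have hlip : LipschitzOnWith 1 f (Icc a b) := LipschitzOnWith.of_dist_le_mul fun s hs t ht => by
      rw [hf s hs t ht, NNReal.coe_one, one_mul]
    have h1 := hlip.comp_eVariationOn_le (f := f) (g := id) (s := Icc x y)
      fun s hs => Icc_subset_Icc hx.1 hy.2 hs
    have h2 := (monotone_id.monotoneOn (Icc x y)).eVariationOn_eq
      (left_mem_Icc.2 hxy) (right_mem_Icc.2 hxy)
    rw [inter_self] at h2
    rw [h2] at h1
    simpa using h1
  · refine le_trans (le_of_eq ?_) (eVariationOn.edist_le f (right_mem_Icc.2 hxy)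
      (left_mem_Icc.2 hxy))
    rw [edist_dist, hf y hy x hx, Real.dist_eq, abs_of_nonneg (sub_nonneg.2 hxy)]

lemma HasUnitSpeedOn.mono_right {f : ℝ → Rn n} {a b c : ℝ} (h : HasUnitSpeedOn f (Icc a c))
    (hb : b ≤ c) : HasUnitSpeedOn f (Icc a b) := by
  intro x hx y hy
  have := h ⟨hx.1, hx.2.trans hb⟩ ⟨hy.1, hy.2.trans hb⟩
  rw [← this]
  congr 1
  ext t
  simp only [mem_inter_iff, mem_Icc]
  constructor
  · rintro ⟨⟨h1, h2⟩, h3, h4⟩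
    exact ⟨⟨h1, h2.trans hb⟩, h3, h4⟩
  · rintro ⟨⟨h1, h2⟩, h3, h4⟩
    exact ⟨⟨h1, h4.trans hy.2⟩, h3, h4⟩

/-- The length of a curve of unit speed, and line integrals over it. -/
lemma lineIntegral_of_hasUnitSpeedOn {f : ℝ → Rn n} {S : ℝ} (hS : 0 < S)
    (hf : HasUnitSpeedOn f (Icc 0 S)) {γ : C(I, Rn n)} (hγ : ∀ t : I, γ t = f (S * t)) :
    curveLength γ ≠ ⊤ ∧ ∀ ρ, lineIntegral ρ γ = ∫⁻ s in Icc 0 S, ρ (f s) := by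
  have hcomp : (γ : I → Rn n) = f ∘ fun t : I => S * t := funext hγ
  have hmono : Monotone fun t : I => S * (t : ℝ) := fun s t hst =>
    mul_le_mul_of_nonneg_left hst hS.le
  have himg : ∀ t : I, (fun t : I => S * (t : ℝ)) '' (univ ∩ Icc 0 t) = Icc 0 (S * t) := by
    intro t
    ext s
    constructor
    · rintro ⟨u, ⟨-, hu0, hut⟩, rfl⟩
      exact ⟨mul_nonneg hS.le u.2.1, mul_le_mul_of_nonneg_left hut hS.le⟩
    · rintro ⟨h0, h1⟩
      have h2 : s / S ≤ t := by rw [div_le_iff₀ hS]; linarith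
      refine ⟨⟨s / S, by positivity, h2.trans t.2.2⟩, ⟨mem_univ _, ?_, h2⟩, ?_⟩
      · exact div_nonneg h0 hS.le
      · simp only
        field_simp
  have hvar : ∀ t : I, eVariationOn γ (univ ∩ Icc 0 t) = ENNReal.ofReal (S * t) := by
    intro t
    have hSt : S * (t : ℝ) ∈ Icc 0 S :=
      ⟨mul_nonneg hS.le t.2.1, mul_le_of_le_one_right hS.le t.2.2⟩
    rw [hcomp, eVariationOn.comp_eq_of_monotoneOn _ _ (hmono.monotoneOn _), himg]
    have := hf (left_mem_Icc.2 hS.le) hSt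
    rw [inter_eq_right.2 (Icc_subset_Icc le_rfl hSt.2), NNReal.coe_one, one_mul, sub_zero] at this
    exact this
  have hlen : curveLength γ = ENNReal.ofReal S := by
    have h1 := hvar 1
    have h2 : (univ ∩ Icc 0 1 : Set I) = univ := by
      ext x
      simpa using unitInterval.le_one'
    rw [h2] at h1
    simpa [curveLength] using h1
  have htop : curveLength γ ≠ ⊤ := by rw [hlen]; exact ENNReal.ofReal_ne_top
  refine ⟨htop, fun ρ => ?_⟩
  unfold lineIntegral
  rw [hlen, ENNReal.toReal_ofReal hS.le]
  refine setLIntegral_congr_fun measurableSet_Icc fun s hs => ?_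
  have hb : BoundedVariationOn γ univ := htop
  let t : I := ⟨s / S, div_nonneg hs.1 hS.le, (div_le_one hS).2 hs.2⟩
  have hst : S * (t : ℝ) = s := by
    show S * (s / S) = s
    field_simp
  -- The length of the curve up to the parameter `s / S` is `s`, so the natural parametrization
  -- agrees with `f`.
  have hv : variationOnFromTo γ univ 0 t = s := by
    rw [variationOnFromTo.eq_of_le _ _ (by exact t.2.1), hvar, hst, ENNReal.toReal_ofReal hs.1]
  have := edist_eq_zero.1 (edist_naturalParameterization_eq_zero hb.locallyBoundedVariationOn
    (mem_univ (0 : I)) (mem_univ t))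
  rw [hv] at this
  rw [this, hγ, hst]

/-- The polygonal curve from `p` over `w` to `q`, parametrized by arc length. -/
def polygon (p w q : Rn n) (s : ℝ) : Rn n :=
  if s ≤ dist p w then p + (s / dist p w) • (w - p)
  else w + ((s - dist p w) / dist w q) • (q - w)

lemma polygon_of_le {p w q : Rn n} {s : ℝ} (hs : s ≤ dist p w) :
    polygon p w q s = p + (s / dist p w) • (w - p) := if_pos hs

lemma polygon_of_ge {p w q : Rn n} {s : ℝ} (hs : dist p w ≤ s) :
    polygon p w q s = w + ((s - dist p w) / dist w q) • (q - w) := by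
  rcases hs.eq_or_lt with rfl | hs
  · rw [polygon_of_le le_rfl, sub_self, zero_div, zero_smul, add_zero]
    rcases eq_or_ne p w with rfl | hpw
    · simp
    · rw [div_self (dist_ne_zero.2 hpw), one_smul, add_sub_cancel]
  · exact if_neg (not_le.2 hs)

lemma polygon_zero (p w q : Rn n) : polygon p w q 0 = p := by
  rw [polygon_of_le dist_nonneg]
  simp

lemma polygon_end (p w q : Rn n) : polygon p w q (dist p w + dist w q) = q := by
  rw [polygon_of_ge (le_add_of_nonneg_right dist_nonneg), add_sub_cancel_left]
  rcases eq_or_ne w q with rfl | hwq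
  · simp
  · rw [div_self (dist_ne_zero.2 hwq), one_smul, add_sub_cancel]

lemma dist_segment_eq (x y : Rn n) {s t a : ℝ} (hs : s ∈ Icc a (a + dist x y))
    (ht : t ∈ Icc a (a + dist x y)) :
    dist (x + ((s - a) / dist x y) • (y - x)) (x + ((t - a) / dist x y) • (y - x)) = dist s t := by
  rcases eq_or_ne x y with rfl | hxy
  · rw [dist_self, add_zero, Icc_self, mem_singleton_iff] at hs ht
    simp [hs, ht]
  · have h0 : 0 < dist x y := dist_pos.2 hxy
    rw [dist_add_left, dist_eq_norm, ← sub_smul, norm_smul, ← dist_eq_norm y, dist_comm y,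
      ← sub_div, Real.norm_eq_abs, abs_div, abs_of_pos h0, div_mul_cancel₀ _ h0.ne', Real.dist_eq]
    congr 1
    ring

lemma hasUnitSpeedOn_polygon (p w q : Rn n) :
    HasUnitSpeedOn (polygon p w q) (Icc 0 (dist p w + dist w q)) := by
  refine HasUnitSpeedOn.Icc_Icc (y := dist p w) (hasUnitSpeedOn_of_isometry fun s hs t ht => ?_)
    (hasUnitSpeedOn_of_isometry fun s hs t ht => ?_)
  · rw [polygon_of_le hs.2, polygon_of_le ht.2]
    have := dist_segment_eq p w (a := 0) (by simpa using hs) (by simpa using ht)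
    simpa using this
  · rw [polygon_of_ge hs.1, polygon_of_ge ht.1]
    exact dist_segment_eq w q hs ht

lemma continuous_polygon (p w q : Rn n) : Continuous (polygon p w q) := by
  have heq : polygon p w q = fun s => if s ≤ dist p w then p + (s / dist p w) • (w - p)
    else w + ((s - dist p w) / dist w q) • (q - w) := rfl
  rw [heq]
  refine Continuous.if_le (by fun_prop) (by fun_prop) continuous_id continuous_const fun s hs => ?_
  rw [← polygon_of_le (q := q) hs.le, polygon_of_ge hs.ge]

lemma lintegral_Icc_div (h : ℝ → ℝ≥0∞) (hh : Measurable h) {ℓ : ℝ} (hℓ : 0 ≤ ℓ) :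
    ∫⁻ s in Icc 0 ℓ, h (s / ℓ) = ENNReal.ofReal ℓ * ∫⁻ t in Ioo (0 : ℝ) 1, h t := by
  rcases hℓ.eq_or_lt with rfl | hℓ
  · simp
  have h1 : ∫⁻ s in Icc 0 ℓ, h (s / ℓ) = ∫⁻ s, (Ioo (0 : ℝ) 1).indicator h (ℓ⁻¹ * s) := by
    rw [setLIntegral_congr Ioo_ae_eq_Icc.symm, ← lintegral_indicator measurableSet_Ioo]
    refine lintegral_congr fun s => ?_
    have : s ∈ Ioo 0 ℓ ↔ ℓ⁻¹ * s ∈ Ioo (0 : ℝ) 1 := by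
      rw [mem_Ioo, mem_Ioo, inv_mul_lt_iff₀ hℓ, mul_one]
      refine and_congr_left fun _ => ⟨fun h => by positivity, fun h => ?_⟩
      exact (mul_pos_iff_of_pos_left (inv_pos.2 hℓ)).1 h
    by_cases hs : s ∈ Ioo 0 ℓ
    · rw [indicator_of_mem hs, indicator_of_mem (this.1 hs), div_eq_inv_mul]
    · rw [indicator_of_notMem hs, indicator_of_notMem (mt this.2 hs)]
  have h2 := Real.map_volume_mul_left (inv_ne_zero hℓ.ne')
  rw [h1, ← lintegral_map (hh.indicator measurableSet_Ioo) (measurable_const_mul ℓ⁻¹), h2,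
    lintegral_smul_measure, inv_inv, abs_of_pos hℓ, lintegral_indicator measurableSet_Ioo,
    smul_eq_mul]

lemma lintegral_polygon_le {ρ : Rn n → ℝ≥0∞} (hρ : Measurable ρ) (p w q : Rn n) :
    ∫⁻ s in Icc 0 (dist p w + dist w q), ρ (polygon p w q s) ≤
      segmentIntegral ρ p w + segmentIntegral ρ q w := by
  have hsub : Icc 0 (dist p w + dist w q) ⊆
      Icc 0 (dist p w) ∪ Icc (dist p w) (dist p w + dist w q) := Icc_subset_Icc_union_Icc
  refine (lintegral_mono_set hsub).trans ((lintegral_union_le _ _ _).trans ?_)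
  gcongr
  · refine le_of_eq ?_
    rw [segmentIntegral, ← lintegral_Icc_div (fun t => ρ (p + t • (w - p)))
      (hρ.comp (by fun_prop)) dist_nonneg]
    exact setLIntegral_congr_fun measurableSet_Icc fun s hs => by rw [polygon_of_le hs.2]
  · refine le_of_eq ?_
    rw [segmentIntegral, ← lintegral_Icc_div (fun t => ρ (q + t • (w - q)))
      (hρ.comp (by fun_prop)) dist_nonneg, ← lintegral_indicator measurableSet_Icc,
      -- The reflection `s ↦ |p - w| + |w - q| - s` turns the second half into the segment traversed
      -- from `q` to `w`.
      ← lintegral_indicator measurableSet_Icc,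
      ← lintegral_sub_left_eq_self _ (dist p w + dist w q)]
    refine lintegral_congr fun s => ?_
    have hiff : dist p w + dist w q - s ∈ Icc (dist p w) (dist p w + dist w q) ↔
        s ∈ Icc 0 (dist q w) := by
      rw [mem_Icc, mem_Icc, dist_comm q w]
      constructor <;> rintro ⟨h1, h2⟩ <;> constructor <;> linarith
    by_cases hs : s ∈ Icc 0 (dist q w)
    · rw [indicator_of_mem hs, indicator_of_mem (hiff.2 hs), polygon_of_ge (hiff.2 hs).1]
      congr 1
      rcases eq_or_ne w q with rfl | hwq
      · simp
      · have h0 : dist w q ≠ 0 := dist_ne_zero.2 hwq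
        rw [dist_comm q w, show (dist p w + dist w q - s - dist p w) / dist w q =
          1 - s / dist w q by field_simp; ring, sub_smul, one_smul, ← neg_sub q w, smul_neg]
        abel
    · rw [indicator_of_notMem hs, indicator_of_notMem (mt hiff.1 hs)]

/-- A density which is admissible for the curves joining `C` to the boundary of `G` is admissible
for the two-segment curves from `C` to the boundary. -/
lemma one_le_segmentIntegral_add {G C : Set (MobiusSpace n)} (hG : IsOpen G) (hC : C ⊆ G)
    {ρ : Rn n → ℝ≥0∞} (hρ : IsAdmissible (joiningCurves C (frontier G) G) ρ) {p q : Rn n}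
    (hp : (p : MobiusSpace n) ∈ C) (hq : (q : MobiusSpace n) ∈ frontier G) (w : Rn n) :
    1 ≤ segmentIntegral ρ p w + segmentIntegral ρ q w := by
  set L := dist p w + dist w q
  set f := polygon p w q
  have hL : 0 ≤ L := by positivity
  have hfc : Continuous fun s => (f s : MobiusSpace n) :=
    OnePoint.continuous_coe.comp (continuous_polygon p w q)
  have hdis : ∀ x, x ∈ G → x ∉ frontier G := fun x hx hx' => by
    rw [frontier, hG.interior_eq] at hx'
    exact hx'.2 hx
  let H : Set ℝ := Icc 0 L ∩ {s | (f s : MobiusSpace n) ∈ frontier G}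
  have hH : IsCompact H := isCompact_Icc.inter_right (isClosed_frontier.preimage hfc)
  have hHne : H.Nonempty := ⟨L, right_mem_Icc.2 hL, by
    show (polygon p w q L : MobiusSpace n) ∈ frontier G
    rwa [polygon_end]⟩
  -- The broken line may leave `G`. Its part up to the first boundary point belongs to the family,
  -- and cutting off the rest only decreases the integral.
  obtain ⟨S, hSH, hSmin⟩ := hH.exists_isLeast hHne
  have hf0 : f 0 = p := polygon_zero p w q
  have hS : 0 < S := by
    refine lt_of_le_of_ne hSH.1.1 fun h => hdis _ (hC hp) ?_
    have := hSH.2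
    rw [← h, mem_ofPred_eq, hf0] at this
    exact this
  have hin : ∀ s ∈ Ico 0 S, (f s : MobiusSpace n) ∈ G := by
    have hpre := (isPreconnected_Ico (a := (0 : ℝ)) (b := S)).image
      (fun s => (f s : MobiusSpace n)) hfc.continuousOn
    have hsub := hpre.subset_of_disjoint_frontier hG (by
      rintro _ ⟨s, hs, rfl⟩ hs'
      exact absurd (hSmin ⟨⟨hs.1, hs.2.le.trans hSH.1.2⟩, hs'⟩) (not_le.2 hs.2))
      ⟨p, ⟨0, ⟨le_rfl, hS⟩, by simp only [hf0]⟩, hC hp⟩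
    exact fun s hs => hsub ⟨s, hs, rfl⟩
  let γ : C(I, Rn n) := ⟨fun t => f (S * t), by
    have := continuous_polygon p w q
    fun_prop⟩
  obtain ⟨hlen, hint⟩ := lineIntegral_of_hasUnitSpeedOn hS
    ((hasUnitSpeedOn_polygon p w q).mono_right hSH.1.2) (γ := γ) fun _ => rfl
  have hmem : finiteCurve γ ∈ joiningCurves C (frontier G) G := by
    refine ⟨?_, ?_, fun t ht0 ht1 => ?_⟩
    · show (f (S * ((0 : I) : ℝ)) : MobiusSpace n) ∈ C
      rw [Icc.coe_zero, mul_zero, hf0]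
      exact hp
    · show (f (S * ((1 : I) : ℝ)) : MobiusSpace n) ∈ frontier G
      rw [Icc.coe_one, mul_one]
      exact hSH.2
    · refine hin _ ⟨mul_nonneg hS.le t.2.1, mul_lt_of_lt_one_right hS ?_⟩
      exact_mod_cast ht1
  refine (hρ.2 γ hmem hlen).trans ?_
  rw [hint]
  exact (lintegral_mono_set (Icc_subset_Icc le_rfl hSH.1.2)).trans (lintegral_polygon_le hρ.1 p w q)

end Polygons

/-! ### Lower bounds for the modulus near a uniformly perfect set -/

section LowerBound

variable {n : ℕ}

/-- Take `β = 1 / m` with `2 ^ (-m) < c / 8`. The bound `β ≤ 1` serves the linear estimate at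
comparable scales. -/
lemma exists_exponent {c : ℝ} (hc : 0 < c) (hc1 : c ≤ 1) :
    ∃ β : ℝ, 0 < β ∧ β ≤ 1 ∧ (ENNReal.ofReal (c / 8) ^ β)⁻¹ < 2 := by
  obtain ⟨m, hm⟩ := exists_pow_lt_of_lt_one (show 0 < c / 8 by positivity)
    (show (1 / 2 : ℝ) < 1 by norm_num)
  have hm0 : m ≠ 0 := by
    rintro rfl
    rw [pow_zero] at hm
    linarith
  have hm1 : (1 : ℝ) ≤ m := by exact_mod_cast Nat.one_le_iff_ne_zero.2 hm0
  refine ⟨(m : ℝ)⁻¹, by positivity, inv_le_one_of_one_le₀ hm1, ?_⟩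
  have h1 : (1 / 2 : ℝ) < (c / 8) ^ (m : ℝ)⁻¹ := by
    have := Real.rpow_lt_rpow (by positivity) hm (show 0 < (m : ℝ)⁻¹ by positivity)
    rwa [Real.pow_rpow_inv_natCast (by positivity) hm0] at this
  rw [ENNReal.ofReal_rpow_of_pos (by positivity), ENNReal.inv_lt_iff_inv_lt]
  have h2 : (2 : ℝ≥0∞)⁻¹ = ENNReal.ofReal (1 / 2) := by
    rw [one_div, ENNReal.ofReal_inv_of_pos two_pos, ENNReal.ofReal_ofNat]
  rw [h2]
  exact (ENNReal.ofReal_lt_ofReal_iff (by positivity)).2 h1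

/-- A connected set is thick up to half of its size. -/
lemma isThickAt_of_isPreconnected {K : Set (MobiusSpace n)} (hK : IsPreconnected K) {c r : ℝ}
    (hc1 : c ≤ 1) {p : Rn n} (hp : (p : MobiusSpace n) ∈ K) {o : MobiusSpace n} (ho : o ∈ K)
    (hor : ∀ z : Rn n, o = z → 2 * r ≤ dist z p) :
    IsThickAt {z : Rn n | (z : MobiusSpace n) ∈ K} c r p := by
  refine ⟨hp, fun a ha hap s hs hsr => ?_⟩
  -- As `|o - p| ≥ 2 r` and `|a - p| ≤ r`, the point `o` lies outside the ball of radius `s ≤ r`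
  -- around `a`, so `K` meets its sphere.
  obtain ⟨z, hz, hzs⟩ := hK.exists_dist_eq (a := a) (r := s) ha (by rw [dist_self]; exact hs.le) ho
    (fun z hz => by
      have h1 := hor z hz
      have h2 := dist_triangle z a p
      linarith)
  exact ⟨z, hz, by rw [hzs]; nlinarith, hzs.le⟩

/-- Provides one direction `v` at angle at most `π / 2` to two given vectors, so that segments from
both towards `v` avoid the centre of the ring. The sign of `v` is free after orthogonality to the
first vector. -/
lemma exists_orthogonal_unit (hn : 2 ≤ n) (u u' : Rn n) :
    ∃ v : Rn n, ‖v‖ = 1 ∧ inner ℝ u v = 0 ∧ 0 ≤ inner ℝ u' v := by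
  obtain ⟨v, hv, hv0⟩ : ∃ v ∈ (Submodule.span ℝ {u})ᗮ, v ≠ 0 := by
    rw [← Submodule.ne_bot_iff, Ne, Submodule.orthogonal_eq_bot_iff]
    intro h
    have h1 := finrank_span_le_card (R := ℝ) ({u} : Set (Rn n))
    rw [h, finrank_top, finrank_euclideanSpace_fin] at h1
    simp at h1
    omega
  have hv1 : ‖‖v‖⁻¹ • v‖ = 1 := by
    rw [norm_smul, norm_inv, norm_norm, inv_mul_cancel₀ (norm_ne_zero_iff.2 hv0)]
  have huv : inner ℝ u (‖v‖⁻¹ • v) = 0 := by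
    rw [inner_smul_right, Submodule.mem_orthogonal_singleton_iff_inner_right.1 hv, mul_zero]
  rcases le_total 0 (inner ℝ u' (‖v‖⁻¹ • v)) with h | h
  · exact ⟨_, hv1, huv, h⟩
  · exact ⟨-(‖v‖⁻¹ • v), by rwa [norm_neg], by rw [inner_neg_right, huv, neg_zero],
      by rw [inner_neg_right]; linarith⟩

/-- Segments between points in directions at angle at most `π / 2` stay away from the origin. -/
lemma segment_mem_ring {a P p w v : Rn n} {c ϱ t : ℝ} (hc : 0 < c) (hϱ : 0 < ϱ)
    (hP : c * ϱ ≤ dist P a) (hP' : dist P a ≤ ϱ) (hv : ‖v‖ = 1) (hPv : 0 ≤ inner ℝ (P - a) v)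
    (hp : dist p P ≤ c * ϱ / 8) (hw : dist w (a + ϱ • v) ≤ c * ϱ / 8) (ht : t ∈ Icc (0 : ℝ) 1) :
    dist (p + t • (w - p)) a ∈ Ioc (c * ϱ / 4) (2 * ϱ) := by
  obtain ⟨ht0, ht1⟩ := ht
  have ht1' : 0 ≤ 1 - t := by linarith
  have hcϱ : 0 < c * ϱ := by positivity
  set A := (1 - t) • (P - a) + t • (ϱ • v) with hA
  set B := (1 - t) • (p - P) + t • (w - (a + ϱ • v)) with hB
  have hsum : p + t • (w - p) - a = A + B := by
    rw [hA, hB]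
    module
  rw [dist_eq_norm] at hP hP' hp hw
  rw [dist_eq_norm, hsum]
  have hBn : ‖B‖ ≤ c * ϱ / 8 := by
    calc ‖B‖ ≤ ‖(1 - t) • (p - P)‖ + ‖t • (w - (a + ϱ • v))‖ := norm_add_le _ _
      _ = (1 - t) * ‖p - P‖ + t * ‖w - (a + ϱ • v)‖ := by
          rw [norm_smul, norm_smul, Real.norm_of_nonneg ht1', Real.norm_of_nonneg ht0]
      _ ≤ (1 - t) * (c * ϱ / 8) + t * (c * ϱ / 8) := by gcongr
      _ = _ := by ring
  have hϱv : ‖ϱ • v‖ = ϱ := by rw [norm_smul, hv, mul_one, Real.norm_of_nonneg hϱ.le]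
  have hAu : ‖A‖ ≤ ϱ := by
    calc ‖A‖ ≤ ‖(1 - t) • (P - a)‖ + ‖t • (ϱ • v)‖ := norm_add_le _ _
      _ = (1 - t) * ‖P - a‖ + t * ϱ := by
          rw [norm_smul, norm_smul, Real.norm_of_nonneg ht1', Real.norm_of_nonneg ht0, hϱv]
      _ ≤ (1 - t) * ϱ + t * ϱ := by gcongr
      _ = _ := by ring
  have hAsq : ‖A‖ ^ 2 = (1 - t) ^ 2 * ‖P - a‖ ^ 2 +
      2 * ((1 - t) * (t * (ϱ * inner ℝ (P - a) v))) + t ^ 2 * ϱ ^ 2 := by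
    rw [hA, norm_add_sq_real, norm_smul, norm_smul, hϱv, inner_smul_left, inner_smul_right,
      inner_smul_right, Real.norm_of_nonneg ht1', Real.norm_of_nonneg ht0]
    simp only [conj_trivial]
    ring
  -- The mixed term is nonnegative and both vectors have length at least `c ϱ`, so `‖A‖ ^ 2 ≥ ((1 -
  -- t) ^ 2 + t ^ 2) (c ϱ) ^ 2`. The perturbation `B` is at most `c ϱ / 8`.
  have hAl : c * ϱ / 2 ≤ ‖A‖ := by
    refine le_of_sq_le_sq ?_ (norm_nonneg A)
    have h1 : (c * ϱ) ^ 2 ≤ ‖P - a‖ ^ 2 := by gcongr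
    have h2 : (c * ϱ) ^ 2 ≤ ϱ ^ 2 := by
      gcongr
      linarith
    have h3 : 0 ≤ (1 - t) * (t * (ϱ * inner ℝ (P - a) v)) := by positivity
    have h4 : (1 - t) ^ 2 * (c * ϱ) ^ 2 ≤ (1 - t) ^ 2 * ‖P - a‖ ^ 2 := by gcongr
    have h5 : t ^ 2 * (c * ϱ) ^ 2 ≤ t ^ 2 * ϱ ^ 2 := by gcongr
    have h6 : (c * ϱ) ^ 2 * (1 / 4) ≤ (c * ϱ) ^ 2 * ((1 - t) ^ 2 + t ^ 2) := by
      gcongr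
      nlinarith [sq_nonneg (2 * t - 1)]
    rw [hAsq]
    nlinarith
  have h7 := norm_add_le A B
  have h8 := norm_sub_le (A + B) B
  rw [add_sub_cancel_right] at h8
  constructor
  · linarith
  · linarith

lemma segmentIntegral_indicator {U : Set (Rn n)} {ρ : Rn n → ℝ≥0∞} {p w : Rn n}
    (h : ∀ t ∈ Icc (0 : ℝ) 1, p + t • (w - p) ∈ U) :
    segmentIntegral (U.indicator ρ) p w = segmentIntegral ρ p w := by
  unfold segmentIntegral
  congr 1
  exact setLIntegral_congr_fun measurableSet_Ioo fun t ht =>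
    indicator_of_mem (h t (Ioo_subset_Icc_self ht)) ρ

/-- The contribution of a single ring to the modulus. -/
lemma exists_ring_lower_bound (hn : 2 ≤ n) {c : ℝ} (hc : 0 < c) (hc1 : c ≤ 1) :
    ∃ κ : ℝ, 0 < κ ∧ ∀ (F : Set (Rn n)) (K : Set (MobiusSpace n)) (ρ : Rn n → ℝ≥0∞)
      (x a : Rn n) (o : MobiusSpace n) (s ϱ : ℝ), IsClosed F → IsClosed K → IsPreconnected K →
      Measurable ρ →
      (∀ p : Rn n, (p : MobiusSpace n) ∈ K → ∀ q ∈ F, ∀ w,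
        1 ≤ segmentIntegral ρ p w + segmentIntegral ρ q w) →
      (∀ a' ∈ F, ∀ r, 0 < r → r ≤ ϱ → IsThickAt F c r a') →
      (x : MobiusSpace n) ∈ K → a ∈ F → dist x a = s → o ∈ K →
      (∀ z : Rn n, o = z → ϱ ≤ dist z a) → 0 < s → 2 * s ≤ ϱ →
      ENNReal.ofReal κ ≤ ∫⁻ z in {z | dist z a ∈ Ioc (c * ϱ / 4) (2 * ϱ)}, ρ z ^ n := by
  obtain ⟨β, hβ, -, hQ⟩ := exists_exponent hc hc1
  obtain ⟨κ, hκ, H⟩ := exists_lower_bound_of_thick hn hc hc1 hβ hQ (32 / c)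
  refine ⟨κ * (c / 32) ^ β, by positivity, ?_⟩
  intro F K ρ x a o s ϱ hF hKc hK hρ hadm hthick hx ha hxa ho hoϱ hs hsϱ
  have hϱ : 0 < ϱ := by linarith
  have hcϱ : c * ϱ ≤ ϱ := by nlinarith
  obtain ⟨p₀, hp₀K, hp₀⟩ := hK.exists_dist_eq (a := a) (r := ϱ) hx (by linarith) ho hoϱ
  obtain ⟨q₀, hq₀F, hq₀, hq₀'⟩ := (hthick a ha ϱ hϱ le_rfl).2 a ha
    (by rw [dist_self]; exact hϱ.le) ϱ hϱ le_rfl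
  obtain ⟨v, hv, hpv, hqv⟩ := exists_orthogonal_unit hn (p₀ - a) (q₀ - a)
  set U : Set (Rn n) := {z | dist z a ∈ Ioc (c * ϱ / 4) (2 * ϱ)} with hU
  have hUm : MeasurableSet U := (measurable_id.dist measurable_const) measurableSet_Ioc
  have hr : 0 < c * ϱ / 8 := by positivity
  have hbound : ∀ P : Rn n, dist P a ≤ ϱ → ∀ p ∈ Metric.closedBall P (c * ϱ / 8),
      ∀ w ∈ Metric.ball (a + ϱ • v) (c * ϱ / 8), dist p w ≤ 4 * ϱ := by
    intro P hP p hp w hw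
    have h1 : dist (a + ϱ • v) a = ϱ := by
      rw [dist_eq_norm, add_sub_cancel_left, norm_smul, hv, mul_one, Real.norm_of_nonneg hϱ.le]
    have h2 := dist_triangle4 p P a (a + ϱ • v)
    have h3 := dist_triangle p (a + ϱ • v) w
    rw [Metric.mem_closedBall] at hp
    rw [Metric.mem_ball, dist_comm] at hw
    rw [dist_comm a, h1] at h2
    linarith
  have hseg : ∀ P : Rn n, c * ϱ ≤ dist P a → dist P a ≤ ϱ → 0 ≤ inner ℝ (P - a) v →
      ∀ p ∈ Metric.closedBall P (c * ϱ / 8), ∀ w ∈ Metric.ball (a + ϱ • v) (c * ϱ / 8),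
      segmentIntegral (U.indicator ρ) p w = segmentIntegral ρ p w := by
    intro P h1 h2 h3 p hp w hw
    refine segmentIntegral_indicator fun t ht => ?_
    exact segment_mem_ring hc hϱ h1 h2 hv h3 hp (Metric.mem_ball.1 hw).le ht
  -- The estimate is applied to `ρ` cut off outside the ring, which is harmless since all segments
  -- involved stay in the ring. `K` is thick at `p₀` because it also contains `x`, and `|x - p₀| ≥ ϱ
  -- - s ≥ ϱ / 2`.
  have := H {z : Rn n | (z : MobiusSpace n) ∈ K} F p₀ q₀ (a + ϱ • v) (c * ϱ / 8) (c * ϱ / 8)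
    (4 * ϱ) (U.indicator ρ) (hKc.preimage OnePoint.continuous_coe) hF hr hr (by positivity)
    (by rw [le_iff_eq_or_lt]; left; field_simp; norm_num)
    (isThickAt_of_isPreconnected hK hc1 hp₀K hx fun z hz => by
      rw [OnePoint.coe_eq_coe] at hz
      subst hz
      have := dist_triangle_left p₀ a x
      rw [hp₀, hxa] at this
      linarith)
    (hthick q₀ hq₀F _ hr (by linarith)) (hρ.indicator hUm)
    (hbound p₀ hp₀.le) (hbound q₀ hq₀')
    (fun p hp q hq w hw => by
      rw [hseg p₀ (by rw [hp₀]; exact hcϱ) hp₀.le hpv.ge p hp.2 w hw,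
        hseg q₀ hq₀ hq₀' hqv q hq.2 w hw]
      exact hadm p hp.1 q hq.1 w)
  have hratio : c * ϱ / 8 / (4 * ϱ) = c / 32 := by field_simp; norm_num
  rw [hratio] at this
  refine this.trans (le_of_eq ?_)
  rw [← lintegral_indicator hUm]
  refine lintegral_congr fun z => ?_
  by_cases hz : z ∈ U
  · rw [indicator_of_mem hz, indicator_of_mem hz]
  · rw [indicator_of_notMem hz, indicator_of_notMem hz, zero_pow (by omega)]

/-- The contributions of consecutive rings add up. -/
lemma exists_rings_lower_bound (hn : 2 ≤ n) {c : ℝ} (hc : 0 < c) (hc1 : c ≤ 1) :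
    ∃ κ : ℝ, 0 < κ ∧ ∀ (F : Set (Rn n)) (K : Set (MobiusSpace n)) (ρ : Rn n → ℝ≥0∞)
      (x a : Rn n) (o : MobiusSpace n) (s R : ℝ) (N : ℕ), IsClosed F → IsClosed K →
      IsPreconnected K → Measurable ρ →
      (∀ p : Rn n, (p : MobiusSpace n) ∈ K → ∀ q ∈ F, ∀ w,
        1 ≤ segmentIntegral ρ p w + segmentIntegral ρ q w) →
      (∀ a' ∈ F, ∀ r, 0 < r → r < R → IsThickAt F c r a') →
      (x : MobiusSpace n) ∈ K → a ∈ F → dist x a = s → o ∈ K →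
      (∀ z : Rn n, o = z → R ≤ dist z x) → 0 < s → (8 / c) ^ N * s + s ≤ R →
      ENNReal.ofReal (κ * N) ≤ ∫⁻ z, ρ z ^ n := by
  obtain ⟨κ, hκ, H⟩ := exists_ring_lower_bound hn hc hc1
  refine ⟨κ, hκ, ?_⟩
  intro F K ρ x a o s R N hF hKc hK hρ hadm hthick hx ha hxa ho hoR hs hN
  set Λ := 8 / c with hΛ
  have hΛ8 : 8 ≤ Λ := by rw [hΛ, le_div_iff₀ hc]; linarith
  have hmono : Monotone fun k : ℕ => 2 * (Λ ^ k * s) := fun i j hij => by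
    have : Λ ^ i ≤ Λ ^ j := pow_le_pow_right₀ (by linarith) hij
    dsimp only
    gcongr
  -- Ring `k` is the one with `ϱ = Λ ^ (k + 1) s`. For `Λ = 8 / c` its inner radius `c ϱ / 4` equals
  -- `2 Λ ^ k s`, the outer radius of the preceding ring.
  let U : ℕ → Set (Rn n) := fun k => {z | dist z a ∈ Ioc (2 * (Λ ^ k * s)) (2 * (Λ ^ (k + 1) * s))}
  have hUm : ∀ k, MeasurableSet (U k) := fun k =>
    (measurable_id.dist measurable_const) measurableSet_Ioc
  have hdisj : Pairwise (Function.onFun Disjoint U) := fun i j hij =>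
    (hmono.pairwise_disjoint_on_Ioc_succ hij).preimage _
  have hring : ∀ k ∈ Finset.range N, ENNReal.ofReal κ ≤ ∫⁻ z in U k, ρ z ^ n := by
    intro k hk
    rw [Finset.mem_range] at hk
    have hle : Λ ^ (k + 1) * s ≤ Λ ^ N * s := by
      gcongr
      · linarith
      · omega
    have h8 : 8 * s ≤ Λ ^ (k + 1) * s := by
      gcongr
      calc 8 ≤ Λ := hΛ8
        _ = Λ ^ 1 := (pow_one Λ).symm
        _ ≤ Λ ^ (k + 1) := pow_le_pow_right₀ (by linarith) (by omega)
    have := H F K ρ x a o s (Λ ^ (k + 1) * s) hF hKc hK hρ hadm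
      (fun a' ha' r hr hr' => hthick a' ha' r hr (by linarith)) hx ha hxa ho
      (fun z hz => by
        have h1 := hoR z hz
        have h2 := dist_triangle z a x
        rw [dist_comm a x, hxa] at h2
        linarith) hs (by linarith)
    have he : c * (Λ ^ (k + 1) * s) / 4 = 2 * (Λ ^ k * s) := by
      rw [pow_succ, hΛ]
      field_simp
      norm_num
    rwa [he] at this
  calc ENNReal.ofReal (κ * N) = ∑ k ∈ Finset.range N, ENNReal.ofReal κ := by
        rw [Finset.sum_const, Finset.card_range, nsmul_eq_mul, ENNReal.ofReal_mul hκ.le,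
          ENNReal.ofReal_natCast, mul_comm]
    _ ≤ ∑ k ∈ Finset.range N, ∫⁻ z in U k, ρ z ^ n := Finset.sum_le_sum hring
    _ = ∫⁻ z in ⋃ k ∈ Finset.range N, U k, ρ z ^ n :=
        (lintegral_biUnion_finset (fun i _ j _ hij => hdisj hij) (fun k _ => hUm k) _).symm
    _ ≤ _ := setLIntegral_le_lintegral _ _

/-- The basic lower bound at comparable scales. -/
lemma exists_linear_lower_bound (hn : 2 ≤ n) {c : ℝ} (hc : 0 < c) (hc1 : c ≤ 1) :
    ∃ κ : ℝ, 0 < κ ∧ ∀ (F : Set (Rn n)) (K : Set (MobiusSpace n)) (ρ : Rn n → ℝ≥0∞)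
      (x a : Rn n) (o : MobiusSpace n) (s R : ℝ), IsClosed F → IsClosed K →
      IsPreconnected K → Measurable ρ →
      (∀ p : Rn n, (p : MobiusSpace n) ∈ K → ∀ q ∈ F, ∀ w,
        1 ≤ segmentIntegral ρ p w + segmentIntegral ρ q w) →
      (∀ a' ∈ F, ∀ r, 0 < r → r < R → IsThickAt F c r a') →
      (x : MobiusSpace n) ∈ K → a ∈ F → dist x a = s → o ∈ K →
      (∀ z : Rn n, o = z → R ≤ dist z x) → 0 < s → 0 < R →
      ENNReal.ofReal (κ * (R / (s + R))) ≤ ∫⁻ z, ρ z ^ n := by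
  obtain ⟨β, hβ, hβ1, hQ⟩ := exists_exponent hc hc1
  obtain ⟨κ, hκ, H⟩ := exists_lower_bound_of_thick hn hc hc1 hβ hQ 2
  refine ⟨κ / 8, by positivity, ?_⟩
  intro F K ρ x a o s R hF hKc hK hρ hadm hthick hx ha hxa ho hoR hs hR
  -- Here `r / ℓ = R / (8 (s + R)) ≤ 1`, so by `β ≤ 1` the power `(r / ℓ) ^ β` is at least `r / ℓ`.
  have := H {z : Rn n | (z : MobiusSpace n) ∈ K} F x a x (R / 4) (s + R) (2 * (s + R)) ρ
    (hKc.preimage OnePoint.continuous_coe) hF (by positivity) (by positivity) (by positivity) le_rfl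
    (isThickAt_of_isPreconnected hK hc1 hx ho fun z hz => by linarith [hoR z hz])
    (hthick a ha _ (by positivity) (by linarith)) hρ
    (fun p hp w hw => by
      rw [Metric.mem_closedBall] at hp
      rw [Metric.mem_ball] at hw
      linarith [dist_triangle_right p w x])
    (fun q hq w hw => by
      rw [Metric.mem_closedBall] at hq
      rw [Metric.mem_ball] at hw
      have h1 := dist_triangle4 q a x w
      rw [dist_comm a x, dist_comm x w] at h1
      linarith)
    (fun p hp q hq w _ => hadm p hp.1 q hq.1 w)
  refine le_trans (ENNReal.ofReal_le_ofReal ?_) this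
  have h1 : R / 4 / (2 * (s + R)) ≤ 1 := by
    rw [div_le_one (by positivity)]
    linarith
  have h2 := Real.rpow_le_rpow_of_exponent_ge (by positivity) h1 hβ1
  rw [Real.rpow_one] at h2
  calc κ / 8 * (R / (s + R)) = κ * (R / 4 / (2 * (s + R))) := by field_simp; norm_num
    _ ≤ _ := by gcongr

/-- For `R ≤ (Λ + 1) s` the logarithm is at most `R / s ≤ (Λ + 2) R / (s + R)`, and the linear bound
applies. Otherwise `N ≥ 1` rings with `Λ ^ N ≤ (R - s) / s < Λ ^ (N + 1)` fit, and `log (1 + R / s)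
≤ (N + 2) log Λ ≤ 3 N log Λ`. -/
lemma exists_log_lower_bound (hn : 2 ≤ n) {c : ℝ} (hc : 0 < c) (hc1 : c ≤ 1) :
    ∃ κ : ℝ, 0 < κ ∧ ∀ (F : Set (Rn n)) (K : Set (MobiusSpace n)) (ρ : Rn n → ℝ≥0∞)
      (x a : Rn n) (o : MobiusSpace n) (s R : ℝ), IsClosed F → IsClosed K →
      IsPreconnected K → Measurable ρ →
      (∀ p : Rn n, (p : MobiusSpace n) ∈ K → ∀ q ∈ F, ∀ w,
        1 ≤ segmentIntegral ρ p w + segmentIntegral ρ q w) →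
      (∀ a' ∈ F, ∀ r, 0 < r → r < R → IsThickAt F c r a') →
      (x : MobiusSpace n) ∈ K → a ∈ F → dist x a = s → o ∈ K →
      (∀ z : Rn n, o = z → R ≤ dist z x) → 0 < s → 0 < R →
      ENNReal.ofReal (κ * Real.log (1 + R / s)) ≤ ∫⁻ z, ρ z ^ n := by
  obtain ⟨κ₁, hκ₁, H₁⟩ := exists_linear_lower_bound hn hc hc1
  obtain ⟨κ₂, hκ₂, H₂⟩ := exists_rings_lower_bound hn hc hc1
  set Λ := 8 / c with hΛ
  have hΛ8 : 8 ≤ Λ := by rw [hΛ, le_div_iff₀ hc]; linarith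
  have hlogΛ : 0 < Real.log Λ := Real.log_pos (by linarith)
  refine ⟨min (κ₁ / (Λ + 2)) (κ₂ / (3 * Real.log Λ)), by positivity, ?_⟩
  intro F K ρ x a o s R hF hKc hK hρ hadm hthick hx ha hxa ho hoR hs hR
  have hlog0 : 0 ≤ Real.log (1 + R / s) := Real.log_nonneg (by
    have : 0 < R / s := by positivity
    linarith)
  rcases le_or_gt R ((Λ + 1) * s) with hcase | hcase
  · refine le_trans (ENNReal.ofReal_le_ofReal ?_)
      (H₁ F K ρ x a o s R hF hKc hK hρ hadm hthick hx ha hxa ho hoR hs hR)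
    have h1 : Real.log (1 + R / s) ≤ R / s := by
      have := Real.log_le_sub_one_of_pos (show 0 < 1 + R / s by positivity)
      linarith
    have h2 : R / s / (Λ + 2) ≤ R / (s + R) := by
      rw [div_div]
      gcongr
      linarith
    calc _ ≤ κ₁ / (Λ + 2) * (R / s) := by
          gcongr
          exact min_le_left _ _
      _ = κ₁ * (R / s / (Λ + 2)) := by ring
      _ ≤ _ := by gcongr
  · have hy : Λ < (R - s) / s := by
      rw [lt_div_iff₀ hs]
      linarith
    obtain ⟨N, hN, hN'⟩ := exists_nat_pow_near (show 1 ≤ (R - s) / s by linarith)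
      (show 1 < Λ by linarith)
    have hN1 : 1 ≤ N := by
      rw [Nat.one_le_iff_ne_zero]
      rintro rfl
      rw [zero_add, pow_one] at hN'
      linarith
    refine le_trans (ENNReal.ofReal_le_ofReal ?_)
      (H₂ F K ρ x a o s R N hF hKc hK hρ hadm hthick hx ha hxa ho hoR hs (by
        rw [le_div_iff₀ hs] at hN
        linarith))
    have hpow : 8 ≤ Λ ^ (N + 1) := hΛ8.trans (by
      calc Λ = Λ ^ 1 := (pow_one Λ).symm
        _ ≤ _ := pow_le_pow_right₀ (by linarith) (by omega))
    have h1 : 1 + R / s ≤ Λ ^ (N + 2) := by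
      have he : R / s = (R - s) / s + 1 := by field_simp; ring
      rw [he, pow_succ Λ (N + 1)]
      nlinarith
    have h2 : Real.log (1 + R / s) ≤ (N + 2) * Real.log Λ := by
      have := Real.log_le_log (by positivity) h1
      rw [Real.log_pow] at this
      push_cast at this
      exact this
    have hN1' : (1 : ℝ) ≤ N := by exact_mod_cast hN1
    calc _ ≤ κ₂ / (3 * Real.log Λ) * ((N + 2) * Real.log Λ) := by
          gcongr
          exact min_le_right _ _
      _ = κ₂ * ((N + 2) / 3) := by field_simp
      _ ≤ _ := by
          gcongr
          linarith

end LowerBound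

/-! ### Uniform perfectness implies the lower bound for the modulus metric -/

section Direct

variable {n : ℕ}

lemma exists_dist_le_of_euclideanDiam_ne_top {E : Set (MobiusSpace n)} (hE : euclideanDiam E ≠ ⊤)
    {a b : MobiusSpace n} (ha : a ∈ E) (hb : b ∈ E) :
    ∃ a' b' : Rn n, a = a' ∧ b = b' ∧ dist a' b' ≤ (euclideanDiam E).toReal := by
  have hinf : OnePoint.infty ∉ E := fun h => hE (by rw [euclideanDiam, if_pos h])
  obtain ⟨a', rfl⟩ := OnePoint.ne_infty_iff_exists.1 fun h => hinf (h ▸ ha)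
  obtain ⟨b', rfl⟩ := OnePoint.ne_infty_iff_exists.1 fun h => hinf (h ▸ hb)
  refine ⟨a', b', rfl, rfl, ?_⟩
  rw [← ENNReal.ofReal_le_iff_le_toReal hE, ← edist_dist, euclideanDiam, if_neg hinf]
  exact Metric.edist_le_ediam_of_mem ha hb

lemma euclideanDiam_pos {E : Set (MobiusSpace n)} (hE : E.Nontrivial) : 0 < euclideanDiam E := by
  by_cases hinf : OnePoint.infty ∈ E
  · rw [euclideanDiam, if_pos hinf]
    exact ENNReal.zero_lt_top
  · rw [euclideanDiam, if_neg hinf, Metric.ediam_pos_iff']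
    obtain ⟨a, ha, b, hb, hab⟩ := hE
    obtain ⟨a', rfl⟩ := OnePoint.ne_infty_iff_exists.1 fun h => hinf (h ▸ ha)
    obtain ⟨b', rfl⟩ := OnePoint.ne_infty_iff_exists.1 fun h => hinf (h ▸ hb)
    exact ⟨a', ha, b', hb, fun h => hab (by rw [h])⟩

lemma euclideanDiam_ne_top {E : Set (MobiusSpace n)} (hE : IsClosed E)
    (hinf : OnePoint.infty ∉ E) : euclideanDiam E ≠ ⊤ := by
  rw [euclideanDiam, if_neg hinf]
  have himg : ((↑) '' {x : Rn n | (x : MobiusSpace n) ∈ E} : Set (MobiusSpace n)) = E := by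
    ext z
    constructor
    · rintro ⟨x, hx, rfl⟩
      exact hx
    · intro hz
      obtain ⟨x, rfl⟩ := OnePoint.ne_infty_iff_exists.1 fun h => hinf (h ▸ hz)
      exact ⟨x, hz, rfl⟩
  rw [← himg] at hE
  exact (OnePoint.isClosed_image_coe.1 hE).2.isBounded.ediam_ne_top

theorem exists_le_modulusMetric (hn : 2 ≤ n) {G : Set (MobiusSpace n)} (hG : IsMobiusDomain G)
    (hcard : (frontier G).Nontrivial) (h : IsUniformlyPerfect (frontier G)) :
    ∃ b : ℝ, 0 < b ∧ ∀ x ∈ G, ∀ y ∈ G,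
      ENNReal.ofReal (b * mobiusMetric G x y) ≤ modulusMetric G x y := by
  obtain ⟨-, -, c, hc, hc1, hperf⟩ := h
  obtain ⟨κ, hκ, H⟩ := exists_log_lower_bound hn hc hc1.le
  -- The Möbius distance is at most a sum of two logarithms, hence twice the larger one.
  refine ⟨κ / 2, by positivity, fun x hx y hy => ?_⟩
  refine le_iInf₂ fun γ hγ => le_iInf₂ fun ρ hρ => ?_
  set D := euclideanDiam (frontier G) with hD
  set F := finiteFrontier G with hF
  have hD0 : 0 < D := euclideanDiam_pos hcard
  have hKc : IsClosed (range γ) := (isCompact_range γ.continuous).isClosed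
  have hK : IsPreconnected (range γ) := isPreconnected_range γ.continuous
  have hxK : x ∈ range γ := ⟨0, γ.source⟩
  have hyK : y ∈ range γ := ⟨1, γ.target⟩
  have key : ∀ (u : Rn n) (o : MobiusSpace n) (R : ℝ), (u : MobiusSpace n) ∈ range γ →
      o ∈ range γ → (∀ z : Rn n, o = z → R ≤ dist z u) → 0 < R → ENNReal.ofReal R ≤ D →
      ENNReal.ofReal (κ * Real.log (1 + R / Metric.infDist u F)) ≤ ∫⁻ z, ρ z ^ n := by
    intro u o R hu ho hoR hR hRD
    obtain ⟨a, ha, hua⟩ := (isClosed_finiteFrontier G).exists_infDist_eq_dist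
      (finiteFrontier_nonempty hcard) u
    refine H F (range γ) ρ u a o _ R (isClosed_finiteFrontier G) hKc hK hρ.1
      (fun p hp q hq w => one_le_segmentIntegral_add hG.1 hγ hρ hp hq w) ?_ hu ha hua.symm ho hoR
      (infDist_finiteFrontier_pos hG hcard (hγ hu)) hR
    intro a' ha' r hr hrR
    refine ⟨ha', fun b hb _ s hs hsr => ?_⟩
    exact hperf b hb s hs
      (((ENNReal.ofReal_lt_ofReal_iff hR).2 (hsr.trans_lt hrR)).trans_le hRD)
  have hzero : mobiusMetric G x y ≤ Real.log 1 →
      ENNReal.ofReal (κ / 2 * mobiusMetric G x y) ≤ ∫⁻ z, ρ z ^ n := fun h0 => by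
    rw [Real.log_one] at h0
    rw [ENNReal.ofReal_of_nonpos (mul_nonpos_of_nonneg_of_nonpos (by positivity) h0)]
    exact zero_le
  have hinfG : OnePoint.infty ∈ G → D ≠ ⊤ ∧ 0 < D.toReal ∧ ENNReal.ofReal D.toReal ≤ D := by
    intro hinf
    have hDt : D ≠ ⊤ := euclideanDiam_ne_top isClosed_frontier fun hmem => by
      rw [frontier, hG.1.interior_eq] at hmem
      exact hmem.2 hinf
    exact ⟨hDt, ENNReal.toReal_pos hD0.ne' hDt, ENNReal.ofReal_toReal_le⟩
  -- If one endpoint is `∞`, then `∂G` is bounded and every absolute ratio is at most `D / d(u)` for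
  -- the finite endpoint `u`, so one logarithm is enough. The distance condition on `o = ∞` is
  -- vacuous.
  have hone : ∀ (u : Rn n) (o : MobiusSpace n), (u : MobiusSpace n) ∈ range γ → o ∈ range γ →
      o = OnePoint.infty →
      mobiusMetric G x y ≤ Real.log (1 + D.toReal / Metric.infDist u F) →
      ENNReal.ofReal (κ / 2 * mobiusMetric G x y) ≤ ∫⁻ z, ρ z ^ n := by
    intro u o hu ho hinf hle
    obtain ⟨-, hDpos, hDle⟩ := hinfG (hinf ▸ hγ ho)
    refine le_trans (ENNReal.ofReal_le_ofReal ?_) (key u o D.toReal hu ho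
      (fun z hz => absurd (hinf.symm.trans hz) (OnePoint.infty_ne_coe z)) hDpos hDle)
    have hpos := infDist_finiteFrontier_pos hG hcard (hγ hu)
    have : 0 ≤ Real.log (1 + D.toReal / Metric.infDist u F) :=
      Real.log_nonneg (le_add_of_nonneg_right (by positivity))
    nlinarith
  induction x using OnePoint.rec with
  | infty =>
    obtain ⟨hDt, -, -⟩ := hinfG hx
    induction y using OnePoint.rec with
    | infty =>
      refine hzero (mobiusMetric_le_log hcard fun a _ b _ => ?_)
      have : absoluteRatio a OnePoint.infty b OnePoint.infty = 0 := by
        show (ratioFactor a b * 0) / _ = (0 : ℝ)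
        simp
      rw [this, add_zero]
    | coe y =>
      refine hone y _ hyK hxK rfl (mobiusMetric_le_log hcard fun a ha b hb => ?_)
      obtain ⟨a', b', rfl, rfl, hab⟩ := exists_dist_le_of_euclideanDiam_ne_top hDt ha hb
      have : absoluteRatio (a' : MobiusSpace n) OnePoint.infty b' y = dist a' b' / dist b' y := by
        show (dist a' b' * 1) / (1 * dist b' y) = _
        simp
      rw [this]
      have hpos := infDist_finiteFrontier_pos hG hcard hy
      gcongr
      exact infDist_finiteFrontier_le hb
  | coe x =>
    induction y using OnePoint.rec with
    | infty =>
      obtain ⟨hDt, -, -⟩ := hinfG hy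
      refine hone x _ hxK hyK rfl (mobiusMetric_le_log hcard fun a ha b hb => ?_)
      obtain ⟨a', b', rfl, rfl, hab⟩ := exists_dist_le_of_euclideanDiam_ne_top hDt ha hb
      have : absoluteRatio (a' : MobiusSpace n) x b' OnePoint.infty = dist a' b' / dist a' x := by
        show (dist a' b' * 1) / (dist a' x * 1) = _
        simp
      rw [this]
      have hpos := infDist_finiteFrontier_pos hG hcard hx
      gcongr
      exact infDist_finiteFrontier_le ha
    | coe y =>
      rcases eq_or_ne x y with rfl | hxy
      · refine hzero (mobiusMetric_le_log hcard fun a _ b _ => ?_)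
        have : absoluteRatio a x b x = 0 := by
          show (ratioFactor a b * dist x x) / _ = (0 : ℝ)
          simp
        rw [this, add_zero]
      have hd : 0 < dist x y := dist_pos.2 hxy
      -- `R` is the minimum of `|x - y|` and `diam ∂G`: up to this scale both the curve and the
      -- boundary are thick.
      obtain ⟨R, hR, hRd, hRD, hRalt⟩ : ∃ R : ℝ, 0 < R ∧ R ≤ dist x y ∧ ENNReal.ofReal R ≤ D ∧
          (dist x y ≤ R ∨ (D ≠ ⊤ ∧ D.toReal ≤ R)) := by
        rcases le_or_gt (ENNReal.ofReal (dist x y)) D with hle | hlt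
        · exact ⟨dist x y, hd, le_rfl, hle, Or.inl le_rfl⟩
        · have hDt : D ≠ ⊤ := hlt.ne_top
          exact ⟨D.toReal, ENNReal.toReal_pos hD0.ne' hDt,
            ENNReal.toReal_le_of_le_ofReal hd.le hlt.le, ENNReal.ofReal_toReal_le,
            Or.inr ⟨hDt, le_rfl⟩⟩
      have hposx := infDist_finiteFrontier_pos hG hcard hx
      have hposy := infDist_finiteFrontier_pos hG hcard hy
      have hlog : mobiusMetric G x y ≤ Real.log ((1 + R / Metric.infDist x F) *
          (1 + R / Metric.infDist y F)) := by
        refine mobiusMetric_le_log hcard fun a ha b hb => ?_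
        refine one_add_absoluteRatio_le hposx hposy
          (fun z hz => infDist_finiteFrontier_le (hz ▸ ha))
          (fun z hz => infDist_finiteFrontier_le (hz ▸ hb)) hRd (hRalt.imp_right ?_)
        rintro ⟨hDt, hDR⟩
        obtain ⟨a', b', h1, h2, hab⟩ := exists_dist_le_of_euclideanDiam_ne_top hDt ha hb
        exact ⟨a', b', h1, h2, hab.trans hDR⟩
      rw [Real.log_mul (by positivity) (by positivity)] at hlog
      have h1 := key x y R hxK hyK (fun z hz => by
        rw [OnePoint.coe_eq_coe] at hz
        subst hz
        rwa [dist_comm]) hR hRD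
      have h2 := key y x R hyK hxK (fun z hz => by
        rw [OnePoint.coe_eq_coe] at hz
        subst hz
        exact hRd) hR hRD
      rcases le_total (Real.log (1 + R / Metric.infDist x F))
        (Real.log (1 + R / Metric.infDist y F)) with hle | hle
      · exact le_trans (ENNReal.ofReal_le_ofReal (by nlinarith)) h2
      · exact le_trans (ENNReal.ofReal_le_ofReal (by nlinarith)) h1

end Direct

end

theorem mainTheorem2 (n : ℕ) (hn : 2 ≤ n) (G : Set (MobiusSpace n))
    (hG : IsMobiusDomain G) (hcard : (frontier G).Nontrivial) :
    IsUniformlyPerfect (frontier G) ↔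
      ∃ b : ℝ, 0 < b ∧ ∀ x ∈ G, ∀ y ∈ G,
        ENNReal.ofReal (b * mobiusMetric G x y) ≤ modulusMetric G x y :=
  ⟨exists_le_modulusMetric hn hG hcard, fun ⟨_, hb, h⟩ =>
    isUniformlyPerfect_of_le_modulusMetric hn hG hcard hb h⟩
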